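/- Let $k\ge 3$. For a permutation $\pi=\pi_1\cdots\pi_{k-1}\in\mathbb S_{k-1}$ let $G_\pi$ be the graph on the vertex set $[k]$ in which $i<j$ are adjacent if and only if the set $\{i,i+1,\dots,j-1\}$ is contiguous in $\pi$, that is, equals $\{\pi_a,\pi_{a+1},\dots,\pi_{a+j-i-1}\}$ for some $a$. Let $\mathcal G_k=\{G_\pi:\pi\in\mathbb S_{k-1}\}$. A permutation in $\mathbb S_{n}$ is simple if no set of consecutive integers with more than one and fewer than $n$ elements is contiguous in it; let $s_i$ be the number of simple permutations in $\mathbb S_{i-1}$. Let $G\in\mathcal G_k$, and place its vertices $1,2,\dots,k$ in this cyclic order at the vertices of a convex $k$-gon. The edges of $G$ that are diagonals of the $k$-gon and are not crossed in its interior by any other edge of $G$ dissect the $k$-gon into polygons, the regions of $G$. A region is complete if every two of its vertices are adjacent in $G$ (so triangles are complete), and it is a cycle if the only edges of $G$ between its vertices are its sides. Two complete regions are connected if they can be joined by a sequence of complete regions in which any two successive ones share a side. Let $c_i$ be the number of regions of $G$ with exactly $i$ vertices that are cycles, for $4<i\le k$, and let $t$ be the number of connected components (classes of pairwise connected regions)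 of the complete regions of $G$. Then $$\bigl|\{\pi\in\mathbb S_{k-1}: G_\pi=G\}\bigr| = 2^t\prod_{i=5}^{k}s_i^{c_i}.$$ -/

import Mathlib

open Finset

/-- The set `X` of values is contiguous in the permutation `π = π₁ π₂ … πₙ`: it is the set of
entries of `π` in the positions from some `a` to some `b`. -/
def IsContiguous {n : ℕ} (π : Equiv.Perm (Fin n)) (X : Set (Fin n)) : Prop :=
  ∃ a b : Fin n, π '' Set.Icc a b = X

/-- `π` is simple: no set of consecutive integers having more than one and fewer than `n` elements
is contiguous in `π`. -/
def IsSimplePerm {n : ℕ} (π : Equiv.Perm (Fin n)) : Prop :=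
  ∀ c d : Fin n, 1 < (Finset.Icc c d).card → (Finset.Icc c d).card < n →
    ¬ IsContiguous π (Set.Icc c d)

/-- The number `s_i` of simple permutations in `S_{i-1}`. -/
noncomputable def simpleCount (i : ℕ) : ℕ :=
  Nat.card {π : Equiv.Perm (Fin (i - 1)) // IsSimplePerm π}

/-- The graph `G_π` of `π ∈ S_{k-1}` on `k` vertices, numbered from `0` here (as are the values and
positions of `π`): vertices `i < j` are adjacent iff `{i, i+1, …, j-1}` is contiguous in `π`. -/
def permGraph (k : ℕ) (π : Equiv.Perm (Fin (k - 1))) : SimpleGraph (Fin k) :=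
  SimpleGraph.fromRel fun i j =>
    i < j ∧ IsContiguous π {v : Fin (k - 1) | i.val ≤ v.val ∧ v.val < j.val}

/-- The family `𝒢_k` of all graphs `G_π`, `π ∈ S_{k-1}`. -/
def permGraphs (k : ℕ) : Set (SimpleGraph (Fin k)) :=
  Set.range (permGraph k)

/-- The vertices `0, 1, …, k-1` are placed on a convex `k`-gon in this cyclic order. The segments
`ab` and `cd` cross in the interior of the polygon: `c` and `d` lie strictly on different sides of
the line through `a` and `b`. -/
def Crosses {k : ℕ} (a b c d : Fin k) : Prop :=
  (c ∈ Set.uIoo a b ∧ d ∉ Set.uIcc a b) ∨ (d ∈ Set.uIoo a b ∧ c ∉ Set.uIcc a b)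

/-- The segment `ab` is a side of the convex polygon with vertex set `S`: its endpoints are distinct
vertices of the polygon, and all other vertices of the polygon lie on the same side of `ab`. -/
def IsSide {k : ℕ} (S : Finset (Fin k)) (a b : Fin k) : Prop :=
  a ∈ S ∧ b ∈ S ∧ a ≠ b ∧ ((∀ c ∈ S, c ∉ Set.uIoo a b) ∨ (∀ c ∈ S, c ∈ Set.uIcc a b))

/-- `ab` is a non-crossing diagonal of `G`: an edge of `G` that is not a side of the `k`-gon and is
not crossed by any edge of `G`. -/
def IsNonCrossingDiagonal {k : ℕ} (G : SimpleGraph (Fin k)) (a b : Fin k) : Prop :=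
  G.Adj a b ∧ ¬ IsSide Finset.univ a b ∧ ∀ c d : Fin k, G.Adj c d → ¬ Crosses a b c d

/-- `S` is the vertex set of a region of the dissection of the `k`-gon by the non-crossing diagonals
of `G`: a polygon all of whose sides are sides of the `k`-gon or non-crossing diagonals, and which
is not divided further by a non-crossing diagonal. -/
def IsRegion {k : ℕ} (G : SimpleGraph (Fin k)) (S : Finset (Fin k)) : Prop :=
  3 ≤ S.card ∧
  (∀ a b : Fin k, IsSide S a b → IsSide Finset.univ a b ∨ IsNonCrossingDiagonal G a b) ∧
  (∀ a ∈ S, ∀ b ∈ S, IsNonCrossingDiagonal G a b → IsSide S a b)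

/-- A region that is a cycle: the edges of `G` between its vertices are exactly its sides. -/
def IsCycleRegion {k : ℕ} (G : SimpleGraph (Fin k)) (S : Finset (Fin k)) : Prop :=
  IsRegion G S ∧ ∀ a ∈ S, ∀ b ∈ S, (G.Adj a b ↔ IsSide S a b)

/-- A complete region: any two of its vertices are adjacent in `G`. Triangles are complete. -/
def IsCompleteRegion {k : ℕ} (G : SimpleGraph (Fin k)) (S : Finset (Fin k)) : Prop :=
  IsRegion G S ∧ G.IsClique (S : Set (Fin k))

/-- The number `c_i` of regions of `G` that are cycles of length `i`. -/
noncomputable def cycleRegionCount {k : ℕ} (G : SimpleGraph (Fin k)) (i : ℕ) : ℕ :=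
  Nat.card {S : Finset (Fin k) // IsCycleRegion G S ∧ S.card = i}

/-- The graph whose vertices are the complete regions of `G`, two different ones being adjacent when
they share a side. -/
def completeRegionGraph {k : ℕ} (G : SimpleGraph (Fin k)) :
    SimpleGraph {S : Finset (Fin k) // IsCompleteRegion G S} :=
  SimpleGraph.fromRel fun R R' => ∃ a b : Fin k, IsSide R.val a b ∧ IsSide R'.val a b

/-- The number `t` of connected components formed by the complete regions of `G`. -/
noncomputable def completeComponentCount {k : ℕ} (G : SimpleGraph (Fin k)) : ℕ :=
  Nat.card (completeRegionGraph G).ConnectedComponent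

/-!
Why the formula holds. An edge `ab` of `G = G_π`, `a < b`, says that the interval `[a, b)` of values
is contiguous in `π`. The contiguous intervals form an `IntervalSystem`: the union, the intersection
and the differences of two overlapping ones are contiguous again. Its strong members, those not
overlapped by any other member, are the sides and non-crossing diagonals of the polygon. They are
nested like the nodes of a tree, and a region of `G` is a node `[i, j)` together with the points
that cut it into its blocks, the maximal strong proper subintervals (`IsRegion.exists_regionAt`,
`RegionAt.isRegion`). A node is complete or cyclic (`IntervalSystem.complete_or_cyclic`), and it has
at least four blocks if it is not complete (`Realizes.exists_five_verts`).

Two values `x ≠ y` lie in different blocks of exactly one node (`IntervalSystem.exists_node`,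
`node_unique`), and as blocks are contiguous, their order in `π` is that of these two blocks. So
`π` is the same thing as an arrangement of the blocks at each node. The arrangements with graph
`G` are singled out by local conditions, collected in `Realizes`: the blocks of a cyclic node form a simple
permutation, those of a complete node are increasing or decreasing, and a complete node and a
complete block of it, that is, two complete regions sharing a side, have opposite directions. Their
necessity is `realizes_posInterval`. Their sufficiency is `Realizes.posInterval_iff_mem`: an
interval of the arrangement that is not in the system would overlap a block of a complete
node, and then this block would be complete with the same direction as the node.

Counting uses one permutation `π₀` with graph `G` for reference. Directions of the complete regions
are admissible if and only if, on each component of complete regions, they all agree with those in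
`π₀` or are all opposite to them. This gives two choices for each component and a simple permutation
for each cycle with at least five vertices.
-/

section

/-! ### Interval systems and their strong intervals -/

/-- A family of integer intervals `[a, b)` inside `[0, n)`, `E a b` saying that `[a, b)` belongs to
the family. It contains the whole interval and the singletons, and it is closed under the Boolean
operations on overlapping intervals. The family of the sets `[a, b)` that are contiguous in a
permutation of `0, …, n - 1` is the example of interest. -/
structure IntervalSystem (n : ℕ) (E : ℕ → ℕ → Prop) : Prop where
  lt : ∀ {a b}, E a b → a < b
  le : ∀ {a b}, E a b → b ≤ n
  unit : ∀ {a}, a < n → E a (a + 1)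
  top : E 0 n
  overlap : ∀ {a b c d}, a < b → b < c → c < d → E a c → E b d →
    E a b ∧ E b c ∧ E c d ∧ E a d

/-- `[a, b)` is a strong interval of the family `E`: no member of `E` overlaps it. -/
def Strong (E : ℕ → ℕ → Prop) (a b : ℕ) : Prop :=
  E a b ∧ ∀ c d, E c d → ¬(a < c ∧ c < b ∧ b < d) ∧ ¬(c < a ∧ a < d ∧ d < b)

/-- A strong interval with at least two elements, that is, an inner node of the tree of strong
intervals. -/
def Node (E : ℕ → ℕ → Prop) (i j : ℕ) : Prop :=
  Strong E i j ∧ i + 2 ≤ j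

/-- `v` is a cut point of `[i, j)`: one of its endpoints, or a point where `[i, j)` is cut when it
is divided into its maximal strong proper subintervals. -/
def Vert (E : ℕ → ℕ → Prop) (i j v : ℕ) : Prop :=
  i ≤ v ∧ v ≤ j ∧ ∀ c d, Strong E c d → i ≤ c → d ≤ j → c < v → v < d → c = i ∧ d = j

/-- `[v, w)` is a block of `[i, j)`: `v` and `w` are consecutive cut points of `[i, j)`. -/
def Block (E : ℕ → ℕ → Prop) (i j v w : ℕ) : Prop :=
  Vert E i j v ∧ Vert E i j w ∧ v < w ∧ ∀ u, Vert E i j u → u ≤ v ∨ w ≤ u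

/-- Any two cut points of `[i, j)` bound a member of `E`. -/
def Complete (E : ℕ → ℕ → Prop) (i j : ℕ) : Prop :=
  ∀ a b, Vert E i j a → Vert E i j b → a < b → E a b

/-- The only members of `E` bounded by cut points of `[i, j)` are the blocks and `[i, j)`. -/
def Cyclic (E : ℕ → ℕ → Prop) (i j : ℕ) : Prop :=
  ∀ a b, Vert E i j a → Vert E i j b → a < b → E a b → Block E i j a b ∨ (a = i ∧ b = j)

variable {n : ℕ} {E : ℕ → ℕ → Prop}

theorem vert_left {i j : ℕ} (h : i ≤ j) : Vert E i j i :=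
  ⟨le_rfl, h, fun c d _ _ _ _ _ => by omega⟩

theorem vert_right {i j : ℕ} (h : i ≤ j) : Vert E i j j :=
  ⟨h, le_rfl, fun c d _ _ _ _ _ => by omega⟩

theorem exists_block {i j x : ℕ} (hi : i ≤ x) (hj : x < j) :
    ∃ v w, Block E i j v w ∧ v ≤ x ∧ x < w := by
  classical
  have hw : ∃ w, Vert E i j w ∧ x < w := ⟨j, vert_right (by omega), hj⟩
  obtain ⟨hw1, hw2⟩ := Nat.find_spec hw
  have hv1 : Vert E i j (Nat.findGreatest (Vert E i j) x) :=
    Nat.findGreatest_spec hi (vert_left (by omega))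
  have hv2 := Nat.findGreatest_le (P := Vert E i j) x
  refine ⟨_, _, ⟨hv1, hw1, by omega, fun u hu => ?_⟩, hv2, hw2⟩
  by_cases hux : u ≤ x
  · exact .inl (Nat.le_findGreatest hux hu)
  · exact .inr (Nat.find_min' hw ⟨hu, by omega⟩)

theorem Block.unique {i j v w v' w' x : ℕ} (h : Block E i j v w) (h' : Block E i j v' w')
    (h1 : v ≤ x) (h2 : x < w) (h1' : v' ≤ x) (h2' : x < w') : v = v' ∧ w = w' := by
  have := h.2.2.2 _ h'.1
  have := h.2.2.2 _ h'.2.1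
  have := h'.2.2.2 _ h.1
  have := h'.2.2.2 _ h.2.1
  omega

theorem Block.disjoint {i j v w v' w' : ℕ} (h : Block E i j v w) (h' : Block E i j v' w')
    (hne : v ≠ v') : w ≤ v' ∨ w' ≤ v := by
  have := h.2.2.2 _ h'.1
  have := h'.2.2.2 _ h.1
  omega

/-- A strong proper subinterval of a node is contained in a block. -/
theorem exists_block_of_strong {i j c d : ℕ} (hT : Strong E c d) (hcd : c < d)
    (hi : i ≤ c) (hj : d ≤ j) (hne : ¬(c = i ∧ d = j)) :
    ∃ v w, Block E i j v w ∧ v ≤ c ∧ d ≤ w := by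
  obtain ⟨v, w, hB, h1, h2⟩ := exists_block (E := E) hi (by omega : c < j)
  refine ⟨v, w, hB, h1, ?_⟩
  by_contra hcon
  exact hne (hB.2.1.2.2 c d hT hi hj h2 (by omega))

/-- Only one node has two given points in different blocks. -/
theorem node_unique {i j v w v' w' i₂ j₂ v₂ w₂ v₂' w₂' x y : ℕ}
    (hN : Node E i j) (hB : Block E i j v w) (hB' : Block E i j v' w') (hne : v ≠ v')
    (hN₂ : Node E i₂ j₂) (hB₂ : Block E i₂ j₂ v₂ w₂) (hB₂' : Block E i₂ j₂ v₂' w₂')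
    (hne₂ : v₂ ≠ v₂')
    (hx : v ≤ x ∧ x < w) (hy : v' ≤ y ∧ y < w') (hx₂ : v₂ ≤ x ∧ x < w₂)
    (hy₂ : v₂' ≤ y ∧ y < w₂') : i = i₂ ∧ j = j₂ := by
  have a1 := hB.1.1
  have a2 := hB.2.1.2.1
  have a3 := hB'.1.1
  have a4 := hB'.2.1.2.1
  have b1 := hB₂.1.1
  have b2 := hB₂.2.1.2.1
  have b3 := hB₂'.1.1
  have b4 := hB₂'.2.1.2.1
  have hlam := hN.1.2 _ _ hN₂.1.1
  by_contra hcon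
  have hnest : (i ≤ i₂ ∧ j₂ ≤ j) ∨ (i₂ ≤ i ∧ j ≤ j₂) := by omega
  rcases hnest with ⟨h1, h2⟩ | ⟨h1, h2⟩
  · obtain ⟨u, t, hB3, h3, h4⟩ :=
      exists_block_of_strong hN₂.1 (by omega) h1 h2 (by omega)
    have e1 := (hB.unique hB3 hx.1 hx.2 (by omega) (by omega)).1
    have e2 := (hB'.unique hB3 hy.1 hy.2 (by omega) (by omega)).1
    omega
  · obtain ⟨u, t, hB3, h3, h4⟩ :=
      exists_block_of_strong hN.1 (by omega) h1 h2 (by omega)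
    have e1 := (hB₂.unique hB3 hx₂.1 hx₂.2 (by omega) (by omega)).1
    have e2 := (hB₂'.unique hB3 hy₂.1 hy₂.2 (by omega) (by omega)).1
    omega

namespace IntervalSystem

theorem strong_unit (H : IntervalSystem n E) {x : ℕ} (hx : x < n) : Strong E x (x + 1) :=
  ⟨H.unit hx, fun c d _ => by omega⟩

theorem strong_top (H : IntervalSystem n E) : Strong E 0 n :=
  ⟨H.top, fun c d h => by have := H.le h; omega⟩

theorem block_strong_and_ne (H : IntervalSystem n E) {i j v w : ℕ} (hN : Node E i j)
    (hB : Block E i j v w) : Strong E v w ∧ ¬(v = i ∧ w = j) := by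
  classical
  obtain ⟨hT, hij⟩ := hN
  obtain ⟨hv, hw, hvw, hcons⟩ := hB
  have hjn := H.le hT.1
  have hvi := hv.1
  have hwj := hw.2.1
  -- The longest strong proper subinterval of `[i, j)` starting at `v` ends at a cut point.
  set P : ℕ → Prop := fun d => Strong E v d ∧ ¬(v = i ∧ d = j) with hP
  have hP0 : P (v + 1) := ⟨H.strong_unit (by omega), by omega⟩
  have hspec : P (Nat.findGreatest P j) := Nat.findGreatest_spec (by omega) hP0
  have hdj := Nat.findGreatest_le (P := P) j
  have hmax : ∀ e, e ≤ j → P e → e ≤ Nat.findGreatest P j :=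
    fun e he h => Nat.le_findGreatest he h
  generalize Nat.findGreatest P j = d at hspec hdj hmax
  obtain ⟨hd, hne⟩ := hspec
  have hvd := H.lt hd.1
  have hKd : Vert E i j d := by
    refine ⟨by omega, hdj, fun c e hce hic hej hcd hde => ?_⟩
    have h1 := hd.2 c e hce.1
    rcases lt_trichotomy c v with h | h | h
    · exact hv.2.2 c e hce hic hej h (by omega)
    · subst h
      by_contra hcon
      have := hmax e hej ⟨hce, hcon⟩
      omega
    · omega
  have hwd : w ≤ d := by
    rcases hcons d hKd with h | h <;> omega
  rcases hwd.eq_or_lt with rfl | h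
  · exact ⟨hd, hne⟩
  · exact absurd (hw.2.2 v d hd hvi hdj hvw h) hne

theorem block_strong (H : IntervalSystem n E) {i j v w : ℕ} (hN : Node E i j)
    (hB : Block E i j v w) : Strong E v w :=
  (H.block_strong_and_ne hN hB).1

theorem exists_vert_between (H : IntervalSystem n E) {i j : ℕ} (hN : Node E i j) :
    ∃ u, Vert E i j u ∧ i < u ∧ u < j := by
  obtain ⟨v, w, hB, h1, h2⟩ := exists_block (E := E) (le_refl i) (by have := hN.2; omega : i < j)
  have := H.block_strong_and_ne hN hB
  have := hB.1.1
  have := hB.2.1.2.1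
  exact ⟨w, hB.2.1, by omega, by omega⟩

/-- Any two points lie in different blocks of some node: the smallest strong interval
containing both. -/
theorem exists_node (H : IntervalSystem n E) {x y : ℕ} (hxy : x < y) (hy : y < n) :
    ∃ i j v w v' w', Node E i j ∧ Block E i j v w ∧ Block E i j v' w' ∧
      v ≤ x ∧ x < w ∧ v' ≤ y ∧ y < w' ∧ w ≤ v' := by
  classical
  have hex : ∃ l, ∃ i j, Strong E i j ∧ i ≤ x ∧ y < j ∧ j = i + l :=
    ⟨n, 0, n, H.strong_top, by omega, hy, by omega⟩
  obtain ⟨i, j, hT, hi, hj, hl⟩ := Nat.find_spec hex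
  have hmin : ∀ a b, Strong E a b → a ≤ x → y < b → j - i ≤ b - a := by
    intro a b hab ha hb
    have := Nat.find_min' hex (m := b - a) ⟨a, b, hab, ha, hb, by omega⟩
    omega
  have hN : Node E i j := ⟨hT, by omega⟩
  obtain ⟨v, w, hB, h1, h2⟩ := exists_block (E := E) hi (hxy.trans hj)
  obtain ⟨v', w', hB', h1', h2'⟩ := exists_block (E := E) (hi.trans hxy.le) hj
  refine ⟨i, j, v, w, v', w', hN, hB, hB', h1, h2, h1', h2', ?_⟩
  obtain ⟨hs, hne⟩ := H.block_strong_and_ne hN hB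
  have hyw : w ≤ y := by
    by_contra hcon
    have := hmin v w hs h1 (by omega)
    have := hB.1.1
    have := hB.2.1.2.1
    omega
  have := hB'.2.2.2 _ hB.2.1
  omega

/-- A strong interval is a block of at most one node. -/
theorem parent_unique (H : IntervalSystem n E) {i j i₂ j₂ v w : ℕ}
    (hN : Node E i j) (hN₂ : Node E i₂ j₂) (hB : Block E i j v w) (hB₂ : Block E i₂ j₂ v w) :
    i = i₂ ∧ j = j₂ := by
  have a0 := hB.2.2.1
  have a1 := hB.1.1
  have a2 := hB.2.1.2.1
  have b1 := hB₂.1.1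
  have b2 := hB₂.2.1.2.1
  have hlam := hN.1.2 _ _ hN₂.1.1
  have c1 := H.block_strong_and_ne hN hB
  have c2 := H.block_strong_and_ne hN₂ hB₂
  by_contra hcon
  have hnest : (i ≤ i₂ ∧ j₂ ≤ j) ∨ (i₂ ≤ i ∧ j ≤ j₂) := by omega
  rcases hnest with ⟨h1, h2⟩ | ⟨h1, h2⟩
  · obtain ⟨u, t, hB3, h3, h4⟩ :=
      exists_block_of_strong hN₂.1 (by omega) h1 h2 (by omega)
    have e1 := hB.unique hB3 (le_refl v) (by omega) (by omega) (by omega)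
    omega
  · obtain ⟨u, t, hB3, h3, h4⟩ :=
      exists_block_of_strong hN.1 (by omega) h1 h2 (by omega)
    have e1 := hB₂.unique hB3 (le_refl v) (by omega) (by omega) (by omega)
    omega

/-! ### Complete and cyclic nodes -/

/-- A member of `E` inside a node, one of whose inner points is a cut point, is bounded by
cut points. -/
theorem vert_of_mem (H : IntervalSystem n E) {i j e f u : ℕ} (hN : Node E i j) (hE : E e f)
    (hi : i ≤ e) (hj : f ≤ j) (hu : Vert E i j u) (h1 : e < u) (h2 : u < f) :
    Vert E i j e ∧ Vert E i j f := by
  constructor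
  · obtain ⟨v, w, hB, h3, h4⟩ := exists_block (E := E) hi (by omega : e < j)
    have := (H.block_strong hN hB).2 _ _ hE
    have := hB.2.2.2 _ hu
    obtain rfl : v = e := by omega
    exact hB.1
  · rcases hj.eq_or_lt with rfl | hj
    · exact vert_right (by omega)
    obtain ⟨v, w, hB, h3, h4⟩ := exists_block (E := E) (by omega : i ≤ f) hj
    have := (H.block_strong hN hB).2 _ _ hE
    have := hB.2.2.2 _ hu
    obtain rfl : v = f := by omega
    exact hB.1

/-- If a node is cut by one of its inner cut points into two members of `E`, then it is
complete: the cut points with this property are closed under refinement, because a gap between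
two consecutive ones is a member of `E`, hence overlapped by another member unless it is a
block. -/
theorem complete_of_split (H : IntervalSystem n E) {i j s : ℕ} (hN : Node E i j)
    (his : i < s) (hsj : s < j) (hs : Vert E i j s) (h1 : E i s) (h2 : E s j) :
    Complete E i j := by
  classical
  have hT := hN.1
  have hij := hN.2
  set A : ℕ → Prop := fun u => Vert E i j u ∧ (i = u ∨ E i u) ∧ (u = j ∨ E u j) with hA
  have hAi : A i := ⟨vert_left (by omega), .inl rfl, .inr hT.1⟩
  have hAj : A j := ⟨vert_right (by omega), .inr hT.1, .inl rfl⟩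
  have hAs : A s := ⟨hs, .inr h1, .inr h2⟩
  have hEAA : ∀ a b, A a → A b → a < b → E a b := by
    rintro a b ⟨hKa, -, ha⟩ ⟨hKb, hb, -⟩ hab
    have h3 := hKa.1
    have h4 := hKb.2.1
    have hb : E i b := hb.resolve_left (by omega)
    have ha : E a j := ha.resolve_left (by omega)
    by_cases e1 : a = i
    · exact e1 ▸ hb
    by_cases e2 : b = j
    · exact e2 ▸ ha
    exact (H.overlap (by omega) hab (by omega) hb ha).2.1
  suffices hall : ∀ u, Vert E i j u → A u from
    fun a b ha hb hab => hEAA a b (hall a ha) (hall b hb) hab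
  intro u hu
  by_contra hnA
  have hiu : i < u := lt_of_le_of_ne hu.1 (fun h => hnA (h ▸ hAi))
  have huj : u < j := lt_of_le_of_ne hu.2.1 (fun h => hnA (h ▸ hAj))
  have hus : u ≠ s := fun h => hnA (h ▸ hAs)
  have hex : ∃ b, A b ∧ u < b := ⟨j, hAj, huj⟩
  obtain ⟨hAb, hub⟩ := Nat.find_spec hex
  have hbmin : ∀ e, A e → u < e → Nat.find hex ≤ e := fun e he h => Nat.find_min' hex ⟨he, h⟩
  have hAa : A (Nat.findGreatest A u) := Nat.findGreatest_spec hiu.le hAi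
  have hau := Nat.findGreatest_le (P := A) u
  have hamax : ∀ e, A e → e ≤ u → e ≤ Nat.findGreatest A u :=
    fun e he h => Nat.le_findGreatest h he
  generalize Nat.find hex = b at hAb hub hbmin
  generalize Nat.findGreatest A u = a at hAa hau hamax
  have hau' : a < u := lt_of_le_of_ne hau (fun h => hnA (h ▸ hAa))
  have hab : E a b := hEAA a b hAa hAb (by omega)
  have hia := hAa.1.1
  have hbj := hAb.1.2.1
  have hgap : ∀ e, A e → a < e → e < b → False := by
    intro e he h3 h4
    rcases lt_trichotomy e u with h | h | h
    · have := hamax e he h.le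
      omega
    · exact hnA (h ▸ he)
    · have := hbmin e he h
      omega
  have hns : ¬ Strong E a b := by
    intro hs'
    have := hu.2.2 a b hs' hia hbj hau' hub
    exact hgap s hAs (by omega) (by omega)
  have hcr : ∃ e f, E e f ∧ ((a < e ∧ e < b ∧ b < f) ∨ (e < a ∧ a < f ∧ f < b)) := by
    by_contra hcon
    push Not at hcon
    refine hns ⟨hab, fun e f hef => ?_⟩
    have := hcon e f hef
    omega
  obtain ⟨e, f, hef, hc⟩ := hcr
  have hTij := hT.2 _ _ hef
  rcases hc with ⟨c1, c2, c3⟩ | ⟨c1, c2, c3⟩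
  · obtain ⟨he, hf⟩ := H.vert_of_mem hN hef (by omega) (by omega) hAb.1 c2 c3
    have hfj := hf.2.1
    refine hgap e ⟨he, .inr ?_, .inr ?_⟩ c1 c2
    · have hib : E i b := hAb.2.1.resolve_left (by omega)
      exact (H.overlap (by omega) c2 c3 hib hef).1
    · have hbj' : E b j := hAb.2.2.resolve_left (by omega)
      rcases hfj.eq_or_lt with rfl | hfj
      · exact hef
      · exact (H.overlap c2 c3 hfj hef hbj').2.2.2
  · obtain ⟨he, hf⟩ := H.vert_of_mem hN hef (by omega) (by omega) hAa.1 c1 c2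
    have hie := he.1
    refine hgap f ⟨hf, .inr ?_, .inr ?_⟩ c2 c3
    · have hia' : E i a := hAa.2.1.resolve_left (by omega)
      rcases hie.eq_or_lt with rfl | hie
      · exact hef
      · exact (H.overlap hie c1 c2 hia' hef).2.2.2
    · have haj' : E a j := hAa.2.2.resolve_left (by omega)
      exact (H.overlap c1 c2 (by omega) hef haj').2.2.1

/-- Every node is complete or cyclic. A longest member of `E` that is bounded by cut points and
is neither a block nor the whole node is overlapped by another one, the union of the two is
the whole node, and this splits the node. -/
theorem complete_or_cyclic (H : IntervalSystem n E) {i j : ℕ} (hN : Node E i j) :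
    Complete E i j ∨ Cyclic E i j := by
  classical
  by_contra hcon
  obtain ⟨hnC, hnY⟩ := not_or.1 hcon
  have hT := hN.1
  set P : ℕ → Prop := fun l => ∃ a, Vert E i j a ∧ Vert E i j (a + l) ∧ E a (a + l) ∧
    ¬ Block E i j a (a + l) ∧ ¬(a = i ∧ a + l = j) with hP
  have hex : ∃ l, l ≤ j ∧ P l := by
    unfold Cyclic at hnY
    push Not at hnY
    obtain ⟨a, b, ha, hb, hab, hE, h1, h2⟩ := hnY
    obtain ⟨l, rfl⟩ := Nat.exists_eq_add_of_lt hab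
    have := hb.2.1
    exact ⟨l + 1, by omega, a, ha, hb, hE, h1, fun h => h2 h.1 h.2⟩
  obtain ⟨l, hl, hPl⟩ := hex
  have hspec : P (Nat.findGreatest P j) := Nat.findGreatest_spec hl hPl
  have hmax : ∀ e, e ≤ j → P e → e ≤ Nat.findGreatest P j :=
    fun e he h => Nat.le_findGreatest he h
  generalize Nat.findGreatest P j = m at hspec hmax
  obtain ⟨a, ha, hb, hE, hnB, hne⟩ := hspec
  generalize hbm : a + m = b at *
  have hab := H.lt hE
  have hmax' : ∀ c d, Vert E i j c → Vert E i j d → E c d → ¬ Block E i j c d → b - a < d - c →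
      c = i ∧ d = j := by
    intro c d hc hd hcd h1 h2
    by_contra h3
    have hlt := H.lt hcd
    have hdj := hd.2.1
    have := hmax (d - c) (by omega) ⟨c, by
      rw [show c + (d - c) = d by omega]; exact ⟨hc, hd, hcd, h1, h3⟩⟩
    omega
  have hu : ∃ u, Vert E i j u ∧ a < u ∧ u < b := by
    by_contra h
    push Not at h
    refine hnB ⟨ha, hb, hab, fun u hu => ?_⟩
    by_contra h3
    have := h u hu (by omega)
    omega
  have hcr : ∃ e f, E e f ∧ ((a < e ∧ e < b ∧ b < f) ∨ (e < a ∧ a < f ∧ f < b)) := by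
    by_contra hcon
    push Not at hcon
    obtain ⟨u, hu, h1, h2⟩ := hu
    refine hne (hu.2.2 a b ⟨hE, fun e f hef => ?_⟩ ha.1 hb.2.1 h1 h2)
    have := hcon e f hef
    omega
  obtain ⟨e, f, hef, hc⟩ := hcr
  have hTij := hT.2 _ _ hef
  have hai := ha.1
  have hbj := hb.2.1
  rcases hc with ⟨c1, c2, c3⟩ | ⟨c1, c2, c3⟩
  · obtain ⟨he, hf⟩ := H.vert_of_mem hN hef (by omega) (by omega) hb c2 c3
    obtain ⟨-, -, o1, o2⟩ := H.overlap c1 c2 c3 hE hef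
    obtain ⟨rfl, rfl⟩ := hmax' a f ha hf o2
      (fun hB => by have := hB.2.2.2 b hb; omega) (by omega)
    exact hnC (H.complete_of_split hN hab c3 hb hE o1)
  · obtain ⟨he, hf⟩ := H.vert_of_mem hN hef (by omega) (by omega) ha c1 c2
    obtain ⟨o1, -, -, o2⟩ := H.overlap c1 c2 c3 hef hE
    obtain ⟨rfl, rfl⟩ := hmax' e b he hb o2
      (fun hB => by have := hB.2.2.2 a ha; omega) (by omega)
    exact hnC (H.complete_of_split hN c1 hab ha o1 hE)

end IntervalSystem

/-! ### Intervals of an arrangement of `0, …, n - 1` -/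

/-- The numbers `0, …, n - 1` being arranged in increasing order of the positions `p`, the set
`[a, b)` is nonempty, contained in `[0, n)`, and occupies consecutive places. -/
def PosInterval (n : ℕ) (p : ℕ → ℤ) (a b : ℕ) : Prop :=
  a < b ∧ b ≤ n ∧ ∀ x y z, a ≤ x → x < b → a ≤ z → z < b → y < n → p x < p y → p y < p z →
    a ≤ y ∧ y < b

theorem posInterval_neg {p : ℕ → ℤ} {a b : ℕ} :
    PosInterval n (fun x => -p x) a b ↔ PosInterval n p a b := by
  constructor
  · rintro ⟨h1, h2, h3⟩
    exact ⟨h1, h2, fun x y z a1 a2 a3 a4 a5 a6 a7 =>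
      h3 z y x a3 a4 a1 a2 a5 (neg_lt_neg a7) (neg_lt_neg a6)⟩
  · rintro ⟨h1, h2, h3⟩
    exact ⟨h1, h2, fun x y z a1 a2 a3 a4 a5 a6 a7 =>
      h3 z y x a3 a4 a1 a2 a5 (neg_lt_neg_iff.1 a7) (neg_lt_neg_iff.1 a6)⟩

theorem posInterval_system {p : ℕ → ℤ} (hn : 0 < n)
    (inj : ∀ x y, x < n → y < n → p x = p y → x = y) :
    IntervalSystem n (PosInterval n p) where
  lt h := h.1
  le h := h.2.1
  unit {a} h := ⟨by omega, by omega, fun x y z h1 h2 h3 h4 _ h6 h7 => by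
    obtain rfl : x = a := by omega
    obtain rfl : z = x := by omega
    omega⟩
  top := ⟨hn, le_rfl, fun _ y _ _ _ _ _ h _ _ => ⟨by omega, h⟩⟩
  overlap {a b c d} hab hbc hcd := by
    rintro ⟨-, h2, h3⟩ ⟨-, h5, h6⟩
    refine ⟨⟨hab, by omega, fun x y z x1 x2 z1 z2 y1 y2 y3 => ?_⟩,
      ⟨hbc, h2, fun x y z x1 x2 z1 z2 y1 y2 y3 => ?_⟩,
      ⟨hcd, h5, fun x y z x1 x2 z1 z2 y1 y2 y3 => ?_⟩,
      ⟨by omega, h5, fun x y z x1 x2 z1 z2 y1 y2 y3 => ?_⟩⟩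
    · have := h3 x y z x1 (by omega) z1 (by omega) y1 y2 y3
      by_contra hcon
      have e1 := h3 x c z x1 (by omega) z1 (by omega) (by omega)
      have e2 := h6 y z c (by omega) (by omega) (by omega) (by omega) (by omega) y3
      have e3 := h6 c x y (by omega) (by omega) (by omega) (by omega) (by omega)
      have e4 := inj c z (by omega) (by omega)
      have e5 := inj c x (by omega) (by omega)
      omega
    · have := h3 x y z (by omega) (by omega) (by omega) (by omega) y1 y2 y3
      have := h6 x y z (by omega) (by omega) (by omega) (by omega) y1 y2 y3
      omega
    · have := h6 x y z (by omega) (by omega) (by omega) (by omega) y1 y2 y3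
      by_contra hcon
      have e1 := h6 x a z (by omega) (by omega) (by omega) (by omega) (by omega)
      have e2 := h3 y z a (by omega) (by omega) (by omega) (by omega) (by omega) y3
      have e3 := h3 a x y (by omega) (by omega) (by omega) (by omega) (by omega)
      have e4 := inj a z (by omega) (by omega)
      have e5 := inj a x (by omega) (by omega)
      omega
    · by_contra hcon
      have e1 := inj y b (by omega) (by omega)
      have e2 : p y < p b ∨ p b < p y := by omega
      rcases e2 with e2 | e2
      · by_cases hx : x < c
        · have := h3 x y b x1 hx (by omega) (by omega) y1 y2 e2
          omega
        · have := h6 x y b (by omega) x2 (by omega) (by omega) y1 y2 e2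
          omega
      · by_cases hz : z < c
        · have := h3 b y z (by omega) (by omega) (by omega) (by omega) y1 e2 y3
          omega
        · have := h6 b y z (by omega) (by omega) (by omega) (by omega) y1 e2 y3
          omega

/-! ### Arrangements compatible with the blocks of an interval system -/

/-- The numbers `0, …, n - 1` have distinct positions, and the order in which points of different
blocks of a node are arranged depends on the blocks only. -/
structure Respects (n : ℕ) (E : ℕ → ℕ → Prop) (p : ℕ → ℤ) : Prop where
  inj : ∀ x y, x < n → y < n → p x = p y → x = y
  resp : ∀ {i j v w v' w' x y}, Node E i j → Block E i j v w → Block E i j v' w' → v ≠ v' →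
    v ≤ x → x < w → v' ≤ y → y < w' → (p x < p y ↔ p v < p v')

/-- The blocks of `[i, j)` are arranged in increasing order. They are arranged in decreasing order
if this holds for the opposite positions. -/
def Inc (E : ℕ → ℕ → Prop) (p : ℕ → ℤ) (i j : ℕ) : Prop :=
  ∀ a b, Vert E i j a → Vert E i j b → a < b → b < j → p a < p b

/-- The local conditions that characterize the arrangements whose intervals are the members of `E`:
at each node the members of `E` bounded by cut points are as prescribed, and a complete
node and a complete block of it are not both increasing or both decreasing. -/
structure Realizes (n : ℕ) (E : ℕ → ℕ → Prop) (p : ℕ → ℤ) : Prop extends Respects n E p where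
  chord : ∀ {i j a b}, Node E i j → Vert E i j a → Vert E i j b → a < b →
    (PosInterval n p a b ↔ E a b)
  alt_inc : ∀ {i j v w}, Node E i j → Complete E i j → Block E i j v w → Node E v w →
    Complete E v w → Inc E p i j → ¬ Inc E p v w
  alt_dec : ∀ {i j v w}, Node E i j → Complete E i j → Block E i j v w → Node E v w →
    Complete E v w → Inc E (fun x => -p x) i j → ¬ Inc E (fun x => -p x) v w

/-- The union `[a, b)` of consecutive blocks of `[i, j)` is contiguous when the blocks of `[i, j)`,
represented by their left endpoints, are arranged by `q`. -/
def BlockInterval (E : ℕ → ℕ → Prop) (q : ℕ → ℤ) (i j a b : ℕ) : Prop :=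
  ∀ x y z, Vert E i j x → Vert E i j y → Vert E i j z → y < j →
    a ≤ x → x < b → a ≤ z → z < b → q x < q y → q y < q z → a ≤ y ∧ y < b

/-- A point outside a strong interval is separated from it by the blocks of some node. -/
theorem IntervalSystem.exists_node_of_strong (H : IntervalSystem n E) {a b y : ℕ}
    (hT : Strong E a b) (hy : y < n) (hyab : y < a ∨ b ≤ y) :
    ∃ i j u t v w, Node E i j ∧ Block E i j u t ∧ Block E i j v w ∧ u ≤ a ∧ b ≤ t ∧
      v ≤ y ∧ y < w ∧ u ≠ v := by
  have hab := H.lt hT.1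
  have hbn := H.le hT.1
  rcases hyab with h | h
  · obtain ⟨i, j, v, w, v', w', hN, hB, hB', h1, h2, h3, h4, h5⟩ :=
      H.exists_node (x := y) (y := b - 1) (by omega) (by omega)
    have := hB.1.1
    have := hB'.2.1.2.1
    have := hN.1.2 _ _ hT.1
    obtain ⟨u, t, hB3, h6, h7⟩ := exists_block_of_strong (i := i) (j := j) hT hab
      (by omega) (by omega) (by omega)
    refine ⟨i, j, u, t, v, w, hN, hB3, hB, h6, h7, h1, h2, ?_⟩
    have := hB3.unique hB' (x := b - 1) (by omega) (by omega) h3 h4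
    have := hB.2.2.1
    omega
  · obtain ⟨i, j, v, w, v', w', hN, hB, hB', h1, h2, h3, h4, h5⟩ :=
      H.exists_node (x := a) (y := y) (by omega) (by omega)
    have := hB.1.1
    have := hB'.2.1.2.1
    have := hN.1.2 _ _ hT.1
    obtain ⟨u, t, hB3, h6, h7⟩ := exists_block_of_strong (i := i) (j := j) hT hab
      (by omega) (by omega) (by omega)
    refine ⟨i, j, u, t, v', w', hN, hB3, hB', h6, h7, h3, h4, ?_⟩
    have := hB3.unique hB (x := a) (by omega) (by omega) h1 h2
    have := hB.2.2.1
    omega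

namespace Respects

variable {p : ℕ → ℤ}

theorem posInterval_of_strong (H : IntervalSystem n E) (R : Respects n E p) {a b : ℕ}
    (hT : Strong E a b) : PosInterval n p a b := by
  have hab := H.lt hT.1
  have hbn := H.le hT.1
  refine ⟨hab, hbn, fun x y z x1 x2 z1 z2 y1 y2 y3 => ?_⟩
  by_contra hcon
  obtain ⟨i, j, u, t, v, w, hN, hB, hB', h1, h2, h3, h4, h5⟩ :=
    H.exists_node_of_strong hT y1 (by omega)
  have := R.resp hN hB hB' h5 (x := x) (by omega) (by omega) h3 h4
  have := R.resp hN hB' hB h5.symm (y := z) h3 h4 (by omega) (by omega)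
  omega

/-- An arrangement is determined by the order of the blocks at each node. -/
theorem order_le (H : IntervalSystem n E) (R : Respects n E p) {q : ℕ → ℤ}
    (Q : Respects n E q)
    (h : ∀ i j v v', Node E i j → Vert E i j v → Vert E i j v' → v < j → v' < j →
      p v < p v' → q v < q v') {x y : ℕ} (hx : x < n) (hy : y < n) (hxy : p x < p y) :
    q x < q y := by
  rcases lt_trichotomy x y with hlt | rfl | hlt
  · obtain ⟨i, j, v, w, v', w', hN, hB, hB', h1, h2, h3, h4, h5⟩ := H.exists_node hlt hy
    have hv := hB.2.2.1
    have := hB.2.1.2.1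
    have := hB'.2.1.2.1
    have := hB'.2.2.1
    rw [Q.resp hN hB hB' (by omega) h1 h2 h3 h4]
    rw [R.resp hN hB hB' (by omega) h1 h2 h3 h4] at hxy
    exact h i j v v' hN hB.1 hB'.1 (by omega) (by omega) hxy
  · omega
  · obtain ⟨i, j, v, w, v', w', hN, hB, hB', h1, h2, h3, h4, h5⟩ := H.exists_node hlt hx
    have hv := hB.2.2.1
    have := hB.2.1.2.1
    have := hB'.2.1.2.1
    have := hB'.2.2.1
    rw [Q.resp hN hB' hB (by omega) h3 h4 h1 h2]
    rw [R.resp hN hB' hB (by omega) h3 h4 h1 h2] at hxy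
    exact h i j v' v hN hB'.1 hB.1 (by omega) (by omega) hxy

theorem lt_of_inc (R : Respects n E p) {i j c x y : ℕ} (hN : Node E i j) (hI : Inc E p i j)
    (hc : Vert E i j c) (hx : i ≤ x) (hxc : x < c) (hcy : c ≤ y) (hy : y < j) : p x < p y := by
  obtain ⟨v, w, hB, h1, h2⟩ := exists_block (E := E) hx (by omega : x < j)
  obtain ⟨v', w', hB', h3, h4⟩ := exists_block (E := E) (by omega : i ≤ y) hy
  have := hB.2.2.2 _ hc
  have := hB'.2.2.2 _ hc
  rw [R.resp hN hB hB' (by omega) h1 h2 h3 h4]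
  exact hI v v' hB.1 hB'.1 (by omega) (by omega)

/-- Whether a union of consecutive blocks of a node is contiguous is decided by the order of
the blocks. -/
theorem posInterval_iff (H : IntervalSystem n E) (R : Respects n E p) {i j a b : ℕ}
    (hN : Node E i j) (ha : Vert E i j a) (hb : Vert E i j b) (hab : a < b) :
    PosInterval n p a b ↔ BlockInterval E p i j a b := by
  have hjn := H.le hN.1.1
  have hia := ha.1
  have hbj := hb.2.1
  constructor
  · intro h x y z _ _ _ hy x1 x2 z1 z2 h1 h2
    exact h.2.2 x y z x1 x2 z1 z2 (by omega) h1 h2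
  · intro h
    refine ⟨hab, by omega, fun x y z x1 x2 z1 z2 y1 h1 h2 => ?_⟩
    obtain ⟨y2, y3⟩ := (posInterval_of_strong H R hN.1).2.2 x y z (by omega) (by omega)
      (by omega) (by omega) y1 h1 h2
    obtain ⟨vx, wx, hBx, x3, x4⟩ := exists_block (E := E) (by omega : i ≤ x) (by omega : x < j)
    obtain ⟨vy, wy, hBy, y4, y5⟩ := exists_block (E := E) y2 y3
    obtain ⟨vz, wz, hBz, z3, z4⟩ := exists_block (E := E) (by omega : i ≤ z) (by omega : z < j)
    have := hBx.2.2.2 _ ha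
    have := hBx.2.2.2 _ hb
    have := hBy.2.2.2 _ ha
    have := hBy.2.2.2 _ hb
    have := hBz.2.2.2 _ ha
    have := hBz.2.2.2 _ hb
    by_contra hcon
    rw [R.resp hN hBx hBy (by omega) x3 x4 y4 y5] at h1
    rw [R.resp hN hBy hBz (by omega) y4 y5 z3 z4] at h2
    have := h vx vy vz hBx.1 hBy.1 hBz.1 (by omega) (by omega) (by omega) (by omega) (by omega)
      h1 h2
    omega

theorem neg (R : Respects n E p) : Respects n E (fun x => -p x) where
  inj x y hx hy h := R.inj x y hx hy (neg_injective h)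
  resp hN hB hB' hne h1 h2 h3 h4 := by
    rw [neg_lt_neg_iff, neg_lt_neg_iff]
    exact R.resp hN hB' hB hne.symm h3 h4 h1 h2

/-- The blocks of a node are arranged monotonically if all unions of consecutive ones are
contiguous. -/
theorem inc_or_dec (H : IntervalSystem n E) (R : Respects n E p) {i j : ℕ} (hN : Node E i j)
    (hP : ∀ a b, Vert E i j a → Vert E i j b → a < b → PosInterval n p a b) :
    Inc E p i j ∨ Inc E (fun x => -p x) i j := by
  have hij := hN.2
  have hjn := H.le hN.1.1
  have hj : Vert E i j j := vert_right (by omega)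
  have hi : Vert E i j i := vert_left (by omega)
  have h3 : ∀ a b c, Vert E i j a → Vert E i j b → Vert E i j c → a < b → b < c → c < j →
      (p a < p b ∧ p b < p c) ∨ (p c < p b ∧ p b < p a) := by
    intro a b c ha hb hc hab hbc hcj
    obtain ⟨v, w, hB, h1, h2⟩ := exists_block (E := E) hb.1 (by omega : b < j)
    have := hB.2.2.2 _ hb
    have := hB.2.2.2 _ hc
    have e1 := (hP a w ha hB.2.1 (by omega)).2.2
    have e2 := (hP b j hb hj (by omega)).2.2
    have f1 := e1 a c b (by omega) (by omega) (by omega) (by omega) (by omega)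
    have f2 := e1 b c a (by omega) (by omega) (by omega) (by omega) (by omega)
    have f3 := e2 b a c (by omega) (by omega) (by omega) (by omega) (by omega)
    have f4 := e2 c a b (by omega) (by omega) (by omega) (by omega) (by omega)
    have g1 := R.inj a b (by omega) (by omega)
    have g2 := R.inj b c (by omega) (by omega)
    have g3 := R.inj a c (by omega) (by omega)
    omega
  have key : ∀ a b, Vert E i j a → Vert E i j b → a < b → b < j → (p a < p b ↔ p i < p b) := by
    intro a b ha hb hab hbj
    rcases ha.1.eq_or_lt with rfl | hia
    · rfl
    · have := h3 i a b hi ha hb hia hab hbj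
      omega
  by_contra hcon
  obtain ⟨hn1, hn2⟩ := not_or.1 hcon
  unfold Inc at hn1 hn2
  push Not at hn1 hn2
  obtain ⟨a, b, ha, hb, hab, hbj, h4⟩ := hn1
  obtain ⟨c, d, hc, hd, hcd, hdj, h5⟩ := hn2
  have k1 := key a b ha hb hab hbj
  have k2 := key c d hc hd hcd hdj
  have := ha.1
  have := hc.1
  have g1 := R.inj a b (by omega) (by omega)
  have g2 := R.inj c d (by omega) (by omega)
  have g3 := R.inj i b (by omega) (by omega)
  rcases lt_trichotomy b d with h | rfl | h
  · have := h3 i b d hi hb hd (by omega) h hdj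
    omega
  · omega
  · have := h3 i d b hi hd hb (by omega) h hbj
    omega

end Respects

namespace Realizes

variable {p : ℕ → ℤ}

theorem neg (R : Realizes n E p) : Realizes n E (fun x => -p x) where
  toRespects := R.toRespects.neg
  chord hN ha hb hab := by rw [posInterval_neg]; exact R.chord hN ha hb hab
  alt_inc := R.alt_dec
  alt_dec hN hC hB hNv hC' := by
    simp only [neg_neg]
    exact R.alt_inc hN hC hB hNv hC'

theorem inc_or_dec (H : IntervalSystem n E) (R : Realizes n E p) {i j : ℕ} (hN : Node E i j)
    (hC : Complete E i j) : Inc E p i j ∨ Inc E (fun x => -p x) i j :=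
  R.toRespects.inc_or_dec H hN fun a b ha hb hab => (R.chord hN ha hb hab).2 (hC a b ha hb hab)

/-- If some proper initial part of a node precedes the rest of it in the arrangement, then the
node is complete and increasing. -/
theorem complete_inc_of_cut (H : IntervalSystem n E) (R : Realizes n E p) {v w c : ℕ}
    (hN : Node E v w) (hvc : v < c) (hcw : c < w)
    (h : ∀ y x, v ≤ y → y < c → c ≤ x → x < w → p y < p x) :
    Complete E v w ∧ Inc E p v w := by
  have hwn := H.le hN.1.1
  -- The point `c` can be replaced by a cut point.
  have key : ∃ c', Vert E v w c' ∧ v < c' ∧ c' < w ∧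
      ∀ y x, v ≤ y → y < c' → c' ≤ x → x < w → p y < p x := by
    obtain ⟨v1, w1, hB, h1, h2⟩ := exists_block (E := E) hvc.le hcw
    have hv1 := hB.1.1
    have hw1 := hB.2.1.2.1
    have hne := (H.block_strong_and_ne hN hB).2
    rcases hv1.eq_or_lt with rfl | hv1
    · refine ⟨w1, hB.2.1, by omega, by omega, fun y x y1 y2 x1 x2 => ?_⟩
      obtain ⟨v2, w2, hB2, h3, h4⟩ := exists_block (E := E) (by omega : v ≤ x) x2
      have := hB2.2.2.2 _ hB.2.1
      rw [R.resp hN hB hB2 (by omega) y1 y2 h3 h4, ← R.resp hN hB hB2 (by omega) le_rfl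
        (by omega) h3 h4]
      exact h v x le_rfl hvc (by omega) x2
    · refine ⟨v1, hB.1, by omega, by omega, fun y x y1 y2 x1 x2 => ?_⟩
      by_cases hx : c ≤ x
      · exact h y x y1 (by omega) hx x2
      obtain ⟨v2, w2, hB2, h3, h4⟩ := exists_block (E := E) y1 (by omega : y < w)
      have := hB2.2.2.2 _ hB.1
      rw [R.resp hN hB2 hB (by omega) h3 h4 x1 (by omega), ← R.resp hN hB2 hB (by omega) h3 h4
        h1 h2]
      exact h y c y1 (by omega) le_rfl hcw
  obtain ⟨c', hc', h1, h2, h3⟩ := key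
  have hvw := (Respects.posInterval_of_strong H R.toRespects hN.1).2.2
  have hl : Vert E v w v := vert_left (by omega)
  have hr : Vert E v w w := vert_right (by omega)
  have e1 : PosInterval n p v c' := by
    refine ⟨h1, by omega, fun x y z x1 x2 z1 z2 y1 y2 y3 => ?_⟩
    have := hvw x y z x1 (by omega) z1 (by omega) y1 y2 y3
    by_contra hcon
    have := h3 z y z1 z2 (by omega) (by omega)
    omega
  have e2 : PosInterval n p c' w := by
    refine ⟨h2, by omega, fun x y z x1 x2 z1 z2 y1 y2 y3 => ?_⟩
    have := hvw x y z (by omega) (by omega) (by omega) (by omega) y1 y2 y3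
    by_contra hcon
    have := h3 y x (by omega) (by omega) (by omega) (by omega)
    omega
  have hC : Complete E v w := H.complete_of_split hN h1 h2 hc'
    ((R.chord hN hl hc' h1).1 e1) ((R.chord hN hc' hr h2).1 e2)
  refine ⟨hC, (R.inc_or_dec H hN hC).resolve_right fun hD => ?_⟩
  have : -p v < -p c' := hD v c' hl hc' h1 h2
  have := h3 v c' le_rfl h1 le_rfl h2
  omega

/-- In an increasing complete node, an interval of the arrangement that reaches into a block
without containing it does not leave the block. -/
theorem not_overlap_of_inc (H : IntervalSystem n E) (R : Realizes n E p) {i j v w c d e : ℕ}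
    (hN : Node E i j) (hC : Complete E i j) (hI : Inc E p i j) (hB : Block E i j v w)
    (hP : PosInterval n p c d) (hve : v < e) (hew : e < w)
    (h : (e = c ∧ w < d ∧ d ≤ j) ∨ (e = d ∧ c < v ∧ i ≤ c)) : False := by
  have hwj := hB.2.1.2.1
  have hiv := hB.1.1
  have hjn := H.le hN.1.1
  have hNv : Node E v w := ⟨H.block_strong hN hB, by omega⟩
  have hcut : ∀ y x, v ≤ y → y < e → e ≤ x → x < w → p y < p x := by
    intro y x y1 y2 x1 x2
    by_contra hcon
    have hne := R.inj x y (by omega) (by omega)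
    rcases h with ⟨rfl, h1, h2⟩ | ⟨rfl, h1, h2⟩
    · have h3 := R.lt_of_inc hN hI hB.2.1 (x := y) (y := w) (by omega) (by omega) le_rfl (by omega)
      have := hP.2.2 x y w (by omega) (by omega) (by omega) (by omega) (by omega) (by omega) h3
      omega
    · have h3 := R.lt_of_inc hN hI hB.1 (x := c) (y := x) (by omega) (by omega) (by omega)
        (by omega)
      have := hP.2.2 c x y (by omega) (by omega) (by omega) (by omega) (by omega) h3 (by omega)
      omega
  obtain ⟨hC', hI'⟩ := R.complete_inc_of_cut H hNv hve hew hcut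
  exact R.alt_inc hN hC hB hNv hC' hI hI'

theorem not_overlap (H : IntervalSystem n E) (R : Realizes n E p) {i j v w c d e : ℕ}
    (hN : Node E i j) (hC : Complete E i j) (hB : Block E i j v w)
    (hP : PosInterval n p c d) (hve : v < e) (hew : e < w)
    (h : (e = c ∧ w < d ∧ d ≤ j) ∨ (e = d ∧ c < v ∧ i ≤ c)) : False := by
  rcases R.inc_or_dec H hN hC with hI | hI
  · exact R.not_overlap_of_inc H hN hC hI hB hP hve hew h
  · exact R.neg.not_overlap_of_inc H hN hC hI hB (posInterval_neg.2 hP) hve hew h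

end Realizes

/-! ### The arrangements whose intervals form a given interval system -/

theorem Vert.exists_block {i j v : ℕ} (hv : Vert E i j v) (hvj : v < j) :
    ∃ w, Block E i j v w := by
  obtain ⟨v', w, hB, h1, h2⟩ := _root_.exists_block (E := E) hv.1 hvj
  have := hB.2.2.2 v hv
  obtain rfl : v' = v := by omega
  exact ⟨w, hB⟩

/-- An arrangement that satisfies the local conditions has exactly the members of `E` as its
intervals. -/
theorem Realizes.posInterval_iff_mem {p : ℕ → ℤ} (H : IntervalSystem n E) (R : Realizes n E p)
    {c d : ℕ} : PosInterval n p c d ↔ E c d := by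
  have Hp := posInterval_system (H.lt H.top) R.inj
  constructor
  · intro hP
    have hcd := Hp.lt hP
    have hdn := Hp.le hP
    rcases Nat.lt_or_ge (c + 1) d with hlt | hge
    swap
    · obtain rfl : d = c + 1 := by omega
      exact H.unit (by omega)
    obtain ⟨i, j, v, w, v', w', hN, hB, hB', h1, h2, h3, h4, h5⟩ :=
      H.exists_node (x := c) (y := d - 1) (by omega) (by omega)
    have hi := hB.1.1
    have hj := hB'.2.1.2.1
    have hvw := hB.2.2.1
    have hvw' := hB'.2.2.1
    have hPB := Respects.posInterval_of_strong H R.toRespects (H.block_strong hN hB)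
    have hPB' := Respects.posInterval_of_strong H R.toRespects (H.block_strong hN hB')
    by_cases hvc : v = c
    · subst hvc
      by_cases hdw : d = w'
      · subst hdw
        exact (R.chord hN hB.1 hB'.2.1 hcd).1 hP
      exfalso
      have hC : Complete E i j := by
        by_contra hnC
        have hY := (H.complete_or_cyclic hN).resolve_left hnC
        obtain ⟨o1, -, -, o2⟩ := Hp.overlap (by omega) (by omega) (by omega) hP hPB'
        have e1 := hY _ _ hB.1 hB'.1 (by omega) ((R.chord hN hB.1 hB'.1 (by omega)).1 o1)
        have e2 := hY _ _ hB.1 hB'.2.1 (by omega) ((R.chord hN hB.1 hB'.2.1 (by omega)).1 o2)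
        rcases e2 with e2 | ⟨rfl, rfl⟩
        · have := e2.2.2.2 _ hB'.1
          omega
        rcases e1 with e1 | e1
        · exact hnC (H.complete_of_split hN (by omega) (by omega) hB'.1
            (H.block_strong hN e1).1 (H.block_strong hN hB').1)
        · omega
      exact R.not_overlap H hN hC hB' hP (e := d) (by omega) (by omega)
        (.inr ⟨rfl, by omega, by omega⟩)
    · exfalso
      have hC : Complete E i j := by
        by_contra hnC
        have hY := (H.complete_or_cyclic hN).resolve_left hnC
        obtain ⟨-, -, o1, o2⟩ := Hp.overlap (by omega) (by omega) (by omega) hPB hP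
        have o3 : PosInterval n p v w' := by
          by_cases hdw : d = w'
          · exact hdw ▸ o2
          · exact (Hp.overlap (by omega) (by omega) (by omega) o2 hPB').2.2.2
        have o4 : PosInterval n p w w' := by
          by_cases hdw : d = w'
          · exact hdw ▸ o1
          rcases h5.eq_or_lt with rfl | h5
          · exact hPB'
          · exact (Hp.overlap h5 (by omega) (by omega) o1 hPB').2.2.2
        have e1 := hY _ _ hB.2.1 hB'.2.1 (by omega)
          ((R.chord hN hB.2.1 hB'.2.1 (by omega)).1 o4)
        have e2 := hY _ _ hB.1 hB'.2.1 (by omega) ((R.chord hN hB.1 hB'.2.1 (by omega)).1 o3)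
        rcases e2 with e2 | ⟨rfl, rfl⟩
        · have := e2.2.2.2 _ hB.2.1
          omega
        rcases e1 with e1 | e1
        · exact hnC (H.complete_of_split hN (by omega) (by omega) hB.2.1
            (H.block_strong hN hB).1 (H.block_strong hN e1).1)
        · omega
      exact R.not_overlap H hN hC hB hP (e := c) (by omega) (by omega)
        (.inl ⟨rfl, by omega, by omega⟩)
  · intro hE
    have hcd := H.lt hE
    have hdn := H.le hE
    rcases Nat.lt_or_ge (c + 1) d with hlt | hge
    swap
    · obtain rfl : d = c + 1 := by omega
      exact Hp.unit (by omega)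
    obtain ⟨i, j, v, w, v', w', hN, hB, hB', h1, h2, h3, h4, h5⟩ :=
      H.exists_node (x := c) (y := d - 1) (by omega) (by omega)
    have hT := (H.block_strong hN hB).2 _ _ hE
    have hT' := (H.block_strong hN hB').2 _ _ hE
    have hvw := hB.2.2.1
    obtain rfl : v = c := by omega
    obtain rfl : d = w' := by omega
    exact (R.chord hN hB.1 hB'.2.1 hcd).2 hE

/-- If a complete node and a complete block of it were both increasing, then a proper part of
this block together with a neighbouring block would be contiguous. -/
theorem Respects.not_inc_of_inc {p : ℕ → ℤ} (H : IntervalSystem n E) (R : Respects n E p)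
    (hE : ∀ a b, PosInterval n p a b ↔ E a b) {i j v w : ℕ} (hN : Node E i j)
    (hC : Complete E i j) (hB : Block E i j v w) (hNv : Node E v w) (hI : Inc E p i j) :
    ¬ Inc E p v w := by
  intro hI'
  obtain ⟨c, hc, h1, h2⟩ := H.exists_vert_between hNv
  have hjn := H.le hN.1.1
  have hne := (H.block_strong_and_ne hN hB).2
  have hiv := hB.1.1
  have hwj := hB.2.1.2.1
  rcases hwj.lt_or_eq with hwj | rfl
  · obtain ⟨w2, hB2⟩ := hB.2.1.exists_block hwj
    have hw2 := hB2.2.2.1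
    have hw2j := hB2.2.1.2.1
    have hP := (hE v w2).2 (hC v w2 hB.1 hB2.2.1 (by omega))
    have hP' : PosInterval n p c w2 := by
      refine ⟨by omega, by omega, fun x y z x1 x2 z1 z2 y1 y2 y3 => ?_⟩
      have := hP.2.2 x y z (by omega) x2 (by omega) z2 y1 y2 y3
      by_contra hcon
      have : p y < p x := by
        by_cases hx : x < w
        · exact R.lt_of_inc hNv hI' hc (by omega) (by omega) x1 hx
        · exact R.lt_of_inc hN hI hB.2.1 (by omega) (by omega) (by omega) (by omega)
      omega
    have := hNv.1.2 _ _ ((hE c w2).1 hP')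
    omega
  · obtain ⟨u, t, hB2, h3, h4⟩ := exists_block (E := E) (x := v - 1) (by omega : i ≤ v - 1)
      (by omega : v - 1 < w)
    have := hB2.2.2.2 _ hB.1
    have hiu := hB2.1.1
    have hP := (hE u w).2 (hC u w hB2.1 hB.2.1 (by omega))
    have hP' : PosInterval n p u c := by
      refine ⟨by omega, by omega, fun x y z x1 x2 z1 z2 y1 y2 y3 => ?_⟩
      have := hP.2.2 x y z (by omega) (by omega) (by omega) (by omega) y1 y2 y3
      by_contra hcon
      have : p z < p y := by
        by_cases hz : v ≤ z
        · exact R.lt_of_inc hNv hI' hc hz z2 (by omega) (by omega)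
        · exact R.lt_of_inc hN hI hB.1 (by omega) (by omega) (by omega) (by omega)
      omega
    have := hNv.1.2 _ _ ((hE u c).1 hP')
    omega

/-- The intervals of an arrangement satisfy the local conditions. -/
theorem realizes_posInterval {p : ℕ → ℤ} (H : IntervalSystem n E)
    (inj : ∀ x y, x < n → y < n → p x = p y → x = y)
    (hE : ∀ a b, PosInterval n p a b ↔ E a b) : Realizes n E p := by
  have R : Respects n E p := by
    refine ⟨inj, fun {i j v w v' w' x y} hN hB hB' hne h1 h2 h3 h4 => ?_⟩
    have a1 := hB.2.2.1
    have a2 := hB'.2.2.1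
    have a3 := hB.disjoint hB' hne
    have a4 := H.le (H.block_strong hN hB).1
    have a5 := H.le (H.block_strong hN hB').1
    have e1 := ((hE v w).2 (H.block_strong hN hB).1).2.2
    have e2 := ((hE v' w').2 (H.block_strong hN hB').1).2.2
    have f1 := e1 x y v h1 h2 (by omega) (by omega) (by omega)
    have f2 := e1 v y x (by omega) (by omega) h1 h2 (by omega)
    have f3 := e2 y v v' h3 h4 (by omega) (by omega) (by omega)
    have f4 := e2 v' v y (by omega) (by omega) h3 h4 (by omega)
    have g1 := inj y v (by omega) (by omega)
    have g2 := inj y x (by omega) (by omega)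
    have g3 := inj v v' (by omega) (by omega)
    omega
  refine ⟨R, fun _ _ _ _ => hE _ _, fun hN hC hB hNv _ hI => R.not_inc_of_inc H hE hN hC hB hNv hI,
    fun hN hC hB hNv _ hI => R.neg.not_inc_of_inc H (fun a b => ?_) hN hC hB hNv hI⟩
  rw [posInterval_neg, hE]

/-- A node that is not complete has at least four blocks, hence at least five cut points: in every
arrangement of three blocks, the middle one by value is next to another one. -/
theorem Realizes.exists_five_verts {p : ℕ → ℤ} (H : IntervalSystem n E) (R : Realizes n E p)
    {i j : ℕ} (hN : Node E i j) (hC : ¬ Complete E i j) :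
    ∃ u v w, Vert E i j u ∧ Vert E i j v ∧ Vert E i j w ∧ i < u ∧ u < v ∧ v < w ∧ w < j := by
  have hij := hN.2
  have hjn := H.le hN.1.1
  have hi : Vert E i j i := vert_left (by omega)
  have hj : Vert E i j j := vert_right (by omega)
  obtain ⟨u, hB⟩ := hi.exists_block (by omega)
  have hne := (H.block_strong_and_ne hN hB).2
  have h1 := hB.2.2.1
  have h2 := hB.2.1.2.1
  obtain ⟨v, hB2⟩ := hB.2.1.exists_block (by omega)
  have h3 := hB2.2.2.1
  have h4 := hB2.2.1.2.1
  rcases h4.eq_or_lt with rfl | h4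
  · exact absurd (H.complete_of_split hN h1 h3 hB.2.1 (H.block_strong hN hB).1
      (H.block_strong hN hB2).1) hC
  obtain ⟨w, hB3⟩ := hB2.2.1.exists_block h4
  have h5 := hB3.2.2.1
  have h6 := hB3.2.1.2.1
  rcases h6.lt_or_eq with h6 | rfl
  · exact ⟨u, v, w, hB.2.1, hB2.2.1, hB3.2.1, h1, h3, h5, h6⟩
  exfalso
  have hY := (H.complete_or_cyclic hN).resolve_left hC
  have hcases : ∀ x, Vert E i w x → x = i ∨ x = u ∨ x = v ∨ x = w := by
    intro x hx
    have := hx.1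
    have := hx.2.1
    have := hB.2.2.2 x hx
    have := hB2.2.2.2 x hx
    have := hB3.2.2.2 x hx
    omega
  by_cases hmid : (p i < p v ∧ p v < p u) ∨ (p u < p v ∧ p v < p i)
  · have hP : PosInterval n p u w := by
      rw [R.posInterval_iff H hN hB.2.1 hj (by omega)]
      intro x y z hx hy hz hyj x1 x2 z1 z2 y1 y2
      rcases hcases x hx with rfl | rfl | rfl | rfl <;>
      rcases hcases y hy with rfl | rfl | rfl | rfl <;>
      rcases hcases z hz with rfl | rfl | rfl | rfl <;> omega
    rcases hY _ _ hB.2.1 hj (by omega) ((R.chord hN hB.2.1 hj (by omega)).1 hP) with h | h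
    · have := h.2.2.2 _ hB2.2.1
      omega
    · omega
  · have hP : PosInterval n p i v := by
      rw [R.posInterval_iff H hN hi hB2.2.1 (by omega)]
      intro x y z hx hy hz hyj x1 x2 z1 z2 y1 y2
      rcases hcases x hx with rfl | rfl | rfl | rfl <;>
      rcases hcases y hy with rfl | rfl | rfl | rfl <;>
      rcases hcases z hz with rfl | rfl | rfl | rfl <;> omega
    rcases hY _ _ hi hB2.2.1 (by omega) ((R.chord hN hi hB2.2.1 (by omega)).1 hP) with h | h
    · have := h.2.2.2 _ hB.2.1
      omega
    · omega

/-! ### Assembling an arrangement from the orders of the blocks -/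

/-- The relation `x` precedes `y`, when the blocks of the node `[i, j)` are arranged according to
`D i j`: it is decided at the node having `x` and `y` in different blocks. -/
def Precedes (E : ℕ → ℕ → Prop) (D : ℕ → ℕ → ℕ → ℤ) (x y : ℕ) : Prop :=
  ∃ i j v w v' w', Node E i j ∧ Block E i j v w ∧ Block E i j v' w' ∧ (v ≤ x ∧ x < w) ∧
    (v' ≤ y ∧ y < w') ∧ D i j v < D i j v'

theorem precedes_iff {D : ℕ → ℕ → ℕ → ℤ} {i j v w v' w' x y : ℕ}
    (hN : Node E i j) (hB : Block E i j v w) (hB' : Block E i j v' w') (hne : v ≠ v')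
    (hx : v ≤ x ∧ x < w) (hy : v' ≤ y ∧ y < w') :
    Precedes E D x y ↔ D i j v < D i j v' := by
  constructor
  · rintro ⟨i₂, j₂, v₂, w₂, v₂', w₂', hN₂, hB₂, hB₂', hx₂, hy₂, hD⟩
    have hne₂ : v₂ ≠ v₂' := by
      rintro rfl
      omega
    obtain ⟨rfl, rfl⟩ := node_unique hN hB hB' hne hN₂ hB₂ hB₂' hne₂ hx hy hx₂ hy₂
    obtain ⟨rfl, -⟩ := hB.unique hB₂ hx.1 hx.2 hx₂.1 hx₂.2
    obtain ⟨rfl, -⟩ := hB'.unique hB₂' hy.1 hy.2 hy₂.1 hy₂.2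
    exact hD
  · intro hD
    exact ⟨i, j, v, w, v', w', hN, hB, hB', hx, hy, hD⟩

theorem precedes_irrefl {D : ℕ → ℕ → ℕ → ℤ} {x : ℕ} : ¬ Precedes E D x x := by
  rintro ⟨i, j, v, w, v', w', hN, hB, hB', hx, hy, hD⟩
  obtain ⟨rfl, -⟩ := hB.unique hB' hx.1 hx.2 hy.1 hy.2
  omega

theorem precedes_asymm {D : ℕ → ℕ → ℕ → ℤ} {x y : ℕ} (h : Precedes E D x y) :
    ¬ Precedes E D y x := by
  obtain ⟨i, j, v, w, v', w', hN, hB, hB', hx, hy, hD⟩ := h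
  rw [precedes_iff hN hB' hB (by rintro rfl; omega) hy hx]
  omega

theorem precedes_total (H : IntervalSystem n E) {D : ℕ → ℕ → ℕ → ℤ}
    (hD : ∀ i j v v', Node E i j → Vert E i j v → Vert E i j v' → v < j → v' < j →
      D i j v = D i j v' → v = v') {x y : ℕ} (hx : x < n) (hy : y < n) (hne : x ≠ y) :
    Precedes E D x y ∨ Precedes E D y x := by
  wlog hlt : x < y generalizing x y
  · exact (this hy hx hne.symm (by omega)).symm
  obtain ⟨i, j, v, w, v', w', hN, hB, hB', h1, h2, h3, h4, h5⟩ := H.exists_node hlt hy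
  have := hB.2.2.1
  have := hB.2.1.2.1
  have := hB'.2.1.2.1
  have := hB'.2.2.1
  rw [precedes_iff hN hB hB' (by omega) ⟨h1, h2⟩ ⟨h3, h4⟩,
    precedes_iff hN hB' hB (by omega) ⟨h3, h4⟩ ⟨h1, h2⟩]
  have := hD i j v v' hN hB.1 hB'.1 (by omega) (by omega)
  omega

theorem precedes_trans (H : IntervalSystem n E) {D : ℕ → ℕ → ℕ → ℤ} {x y z : ℕ}
    (hx : x < n) (hy : y < n) (hz : z < n) (hxy : Precedes E D x y) (hyz : Precedes E D y z) :
    Precedes E D x z := by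
  have hne : x ≠ z := by
    rintro rfl
    exact precedes_asymm hxy hyz
  -- The node that separates the smallest of the three points from the largest one.
  obtain ⟨i, j, v, w, v', w', hN, hB, hB', h1, h2, h3, h4, h5⟩ :=
    H.exists_node (x := min x (min y z)) (y := max x (max y z)) (by omega) (by omega)
  have hi := hB.1.1
  have hj := hB'.2.1.2.1
  obtain ⟨vx, wx, hBx, x1, x2⟩ := exists_block (E := E) (by omega : i ≤ x) (by omega : x < j)
  obtain ⟨vy, wy, hBy, y1, y2⟩ := exists_block (E := E) (by omega : i ≤ y) (by omega : y < j)
  obtain ⟨vz, wz, hBz, z1, z2⟩ := exists_block (E := E) (by omega : i ≤ z) (by omega : z < j)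
  by_cases e1 : vx = vy
  · subst e1
    have := hBx.2.2.2 _ hBy.2.1
    have := hBy.2.2.2 _ hBx.2.1
    by_cases e2 : vx = vz
    · -- All three points cannot lie in one block.
      subst e2
      have := hBx.2.2.2 _ hBz.2.1
      have := hBz.2.2.2 _ hBx.2.1
      have := hBx.2.2.2 _ hB.2.1
      omega
    · rw [precedes_iff hN hBx hBz e2 ⟨x1, x2⟩ ⟨z1, z2⟩]
      rwa [precedes_iff hN hBy hBz e2 ⟨y1, y2⟩ ⟨z1, z2⟩] at hyz
  · have hxy' := hxy
    rw [precedes_iff hN hBx hBy e1 ⟨x1, x2⟩ ⟨y1, y2⟩] at hxy'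
    by_cases e2 : vy = vz
    · subst e2
      rwa [precedes_iff hN hBx hBz e1 ⟨x1, x2⟩ ⟨z1, z2⟩]
    · rw [precedes_iff hN hBy hBz e2 ⟨y1, y2⟩ ⟨z1, z2⟩] at hyz
      rw [precedes_iff hN hBx hBz (by rintro rfl; omega) ⟨x1, x2⟩ ⟨z1, z2⟩]
      omega

/-- Any choice of orders of the blocks at the nodes comes from an arrangement. -/
theorem exists_arrangement (H : IntervalSystem n E) (D : ℕ → ℕ → ℕ → ℤ)
    (hD : ∀ i j v v', Node E i j → Vert E i j v → Vert E i j v' → v < j → v' < j →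
      D i j v = D i j v' → v = v') :
    ∃ p : ℕ → ℤ, Respects n E p ∧ ∀ i j v v', Node E i j → Vert E i j v → Vert E i j v' →
      v < j → v' < j → (p v < p v' ↔ D i j v < D i j v') := by
  classical
  set p : ℕ → ℤ := fun x => (#{y ∈ range n | Precedes E D y x} : ℕ) with hp
  have h1 : ∀ x y, x < n → y < n → Precedes E D x y → p x < p y := by
    intro x y hx hy hxy
    simp only [hp, Nat.cast_lt]
    refine card_lt_card (ssubset_iff_of_subset ?_ |>.2 ⟨x, ?_, ?_⟩)
    · intro z hz
      simp only [mem_filter, mem_range] at hz ⊢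
      exact ⟨hz.1, precedes_trans H hz.1 hx hy hz.2 hxy⟩
    · simp [hx, hxy]
    · simp [precedes_irrefl]
  have h2 : ∀ x y, x < n → y < n → (p x < p y ↔ Precedes E D x y) := by
    refine fun x y hx hy => ⟨fun h => ?_, h1 x y hx hy⟩
    have hne : x ≠ y := by
      rintro rfl
      omega
    refine (precedes_total H hD hx hy hne).resolve_right fun h' => ?_
    have := h1 y x hy hx h'
    omega
  have h3 : ∀ {i j v w v' w' x y}, Node E i j → Block E i j v w → Block E i j v' w' → v ≠ v' →
      v ≤ x → x < w → v' ≤ y → y < w' → (p x < p y ↔ D i j v < D i j v') := by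
    intro i j v w v' w' x y hN hB hB' hne a1 a2 a3 a4
    have := H.le (H.block_strong hN hB).1
    have := H.le (H.block_strong hN hB').1
    rw [h2 x y (by omega) (by omega), precedes_iff hN hB hB' hne ⟨a1, a2⟩ ⟨a3, a4⟩]
  refine ⟨p, ⟨fun x y hx hy hxy => ?_, fun {i j v w v' w' x y} hN hB hB' hne a1 a2 a3 a4 => ?_⟩,
    fun i j v v' hN hv hv' hvj hvj' => ?_⟩
  · by_contra hne
    have := h1 x y hx hy
    have := h1 y x hy hx
    have := precedes_total H hD hx hy hne
    grind
  · have := hB.2.2.1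
    have := hB'.2.2.1
    rw [h3 hN hB hB' hne a1 a2 a3 a4, h3 hN hB hB' hne le_rfl (by omega) le_rfl (by omega)]
  · obtain ⟨w, hB⟩ := hv.exists_block hvj
    obtain ⟨w', hB'⟩ := hv'.exists_block hvj'
    rcases eq_or_ne v v' with rfl | hne
    · simp
    · exact h3 hN hB hB' hne le_rfl hB.2.2.1 le_rfl hB'.2.2.1

/-- Orders of the blocks at the nodes that satisfy the local conditions come from an arrangement
whose intervals are the members of `E`. -/
theorem exists_realization (H : IntervalSystem n E) (D : ℕ → ℕ → ℕ → ℤ)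
    (hD : ∀ i j v v', Node E i j → Vert E i j v → Vert E i j v' → v < j → v' < j →
      D i j v = D i j v' → v = v')
    (hchord : ∀ i j a b, Node E i j → Vert E i j a → Vert E i j b → a < b →
      (BlockInterval E (D i j) i j a b ↔ E a b))
    (hinc : ∀ i j v w, Node E i j → Complete E i j → Block E i j v w → Node E v w →
      Complete E v w → Inc E (D i j) i j → ¬ Inc E (D v w) v w)
    (hdec : ∀ i j v w, Node E i j → Complete E i j → Block E i j v w → Node E v w →
      Complete E v w → Inc E (fun x => -D i j x) i j → ¬ Inc E (fun x => -D v w x) v w) :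
    ∃ p : ℕ → ℤ, Respects n E p ∧ (∀ a b, PosInterval n p a b ↔ E a b) ∧
      ∀ i j v v', Node E i j → Vert E i j v → Vert E i j v' →
      v < j → v' < j → (p v < p v' ↔ D i j v < D i j v') := by
  obtain ⟨p, R, hp⟩ := exists_arrangement H D hD
  have hI : ∀ {i j}, Node E i j → (Inc E p i j ↔ Inc E (D i j) i j) := fun {i j} hN =>
    ⟨fun h a b ha hb hab hbj => (hp i j a b hN ha hb (by omega) hbj).1 (h a b ha hb hab hbj),
      fun h a b ha hb hab hbj => (hp i j a b hN ha hb (by omega) hbj).2 (h a b ha hb hab hbj)⟩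
  have hI' : ∀ {i j}, Node E i j →
      (Inc E (fun x => -p x) i j ↔ Inc E (fun x => -D i j x) i j) := fun {i j} hN =>
    ⟨fun h a b ha hb hab hbj => neg_lt_neg <| (hp i j b a hN hb ha hbj (by omega)).1 <|
        neg_lt_neg_iff.1 (h a b ha hb hab hbj),
      fun h a b ha hb hab hbj => neg_lt_neg <| (hp i j b a hN hb ha hbj (by omega)).2 <|
        neg_lt_neg_iff.1 (h a b ha hb hab hbj)⟩
  have R' : Realizes n E p := by
    refine ⟨R, fun {i j a b} hN ha hb hab => ?_, fun hN hC hB hNv hCv => ?_,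
      fun hN hC hB hNv hCv => ?_⟩
    · rw [R.posInterval_iff H hN ha hb hab, ← hchord i j a b hN ha hb hab]
      have hbj := hb.2.1
      refine forall₃_congr fun x y z => ⟨fun h hx hy hz hyj x1 x2 z1 z2 y1 y2 => ?_,
        fun h hx hy hz hyj x1 x2 z1 z2 y1 y2 => ?_⟩
      · exact h hx hy hz hyj x1 x2 z1 z2 ((hp i j x y hN hx hy (by omega) hyj).2 y1)
          ((hp i j y z hN hy hz hyj (by omega)).2 y2)
      · exact h hx hy hz hyj x1 x2 z1 z2 ((hp i j x y hN hx hy (by omega) hyj).1 y1)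
          ((hp i j y z hN hy hz hyj (by omega)).1 y2)
    · rw [hI hN, hI hNv]
      exact hinc _ _ _ _ hN hC hB hNv hCv
    · rw [hI' hN, hI' hNv]
      exact hdec _ _ _ _ hN hC hB hNv hCv
  exact ⟨p, R, fun a b => R'.posInterval_iff_mem H, hp⟩

theorem Inc.not_inc_neg (H : IntervalSystem n E) {p : ℕ → ℤ} {i j : ℕ} (hN : Node E i j)
    (h : Inc E p i j) : ¬ Inc E (fun x => -p x) i j := by
  intro h'
  obtain ⟨u, hu, h1, h2⟩ := H.exists_vert_between hN
  have hi : Vert E i j i := vert_left (by omega)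
  have := h i u hi hu h1 h2
  have : -p i < -p u := h' i u hi hu h1 h2
  omega

theorem Realizes.inc_iff_not_inc (H : IntervalSystem n E) {p : ℕ → ℤ} (R : Realizes n E p)
    {i j v w : ℕ} (hN : Node E i j) (hC : Complete E i j) (hB : Block E i j v w)
    (hN' : Node E v w) (hC' : Complete E v w) : Inc E p i j ↔ ¬ Inc E p v w := by
  refine ⟨R.alt_inc hN hC hB hN' hC', fun h => ?_⟩
  by_contra hcon
  exact R.alt_dec hN hC hB hN' hC' ((R.inc_or_dec H hN hC).resolve_left hcon)
    ((R.inc_or_dec H hN' hC').resolve_left h)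

end

/-! ### The interval system of a graph on the vertices of a polygon -/

/-- The edges of a graph on `Fin k`, as a family of integer intervals: an edge `ab` with `a < b`
stands for `[a, b)`. -/
def edgeIntervals {k : ℕ} (G : SimpleGraph (Fin k)) (a b : ℕ) : Prop :=
  ∃ (ha : a < k) (hb : b < k), a < b ∧ G.Adj ⟨a, ha⟩ ⟨b, hb⟩

/-- The positions of the values in a permutation (with `0` for numbers that are not values). -/
def pos {m : ℕ} (π : Equiv.Perm (Fin m)) (x : ℕ) : ℤ :=
  if h : x < m then ((π.symm ⟨x, h⟩ : Fin m) : ℕ) else 0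

theorem pos_val {m : ℕ} (π : Equiv.Perm (Fin m)) (x : Fin m) :
    pos π x = ((π.symm x : Fin m) : ℕ) := by
  simp [pos]

theorem pos_inj {m : ℕ} (π : Equiv.Perm (Fin m)) (x y : ℕ) (hx : x < m) (hy : y < m)
    (h : pos π x = pos π y) : x = y := by
  have h1 := pos_val π ⟨x, hx⟩
  have h2 := pos_val π ⟨y, hy⟩
  simp only at h1 h2
  have : π.symm ⟨x, hx⟩ = π.symm ⟨y, hy⟩ := Fin.ext (by omega)
  simpa using this

theorem isContiguous_iff {m : ℕ} (π : Equiv.Perm (Fin m)) {X : Set (Fin m)} (hX : X.Nonempty) :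
    IsContiguous π X ↔ ∀ x y z, x ∈ X → z ∈ X → π.symm x < π.symm y → π.symm y < π.symm z →
      y ∈ X := by
  classical
  constructor
  · rintro ⟨a, b, rfl⟩ x y z ⟨x, hx, rfl⟩ ⟨z, hz, rfl⟩ h1 h2
    rw [Equiv.symm_apply_apply] at h1 h2
    exact ⟨π.symm y, ⟨hx.1.trans h1.le, h2.le.trans hz.2⟩, by simp⟩
  · intro h
    set Y : Finset (Fin m) := {a | π a ∈ X} with hY
    have hne : Y.Nonempty := by
      obtain ⟨x, hx⟩ := hX
      exact ⟨π.symm x, by simpa [hY] using hx⟩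
    have h1 : π (Y.min' hne) ∈ X := by simpa [hY] using Y.min'_mem hne
    have h2 : π (Y.max' hne) ∈ X := by simpa [hY] using Y.max'_mem hne
    refine ⟨Y.min' hne, Y.max' hne, Set.ext fun x => ⟨?_, fun hx => ?_⟩⟩
    · rintro ⟨c, ⟨hc1, hc2⟩, rfl⟩
      rcases hc1.eq_or_lt with rfl | hc1
      · exact h1
      rcases hc2.eq_or_lt with rfl | hc2
      · exact h2
      exact h _ _ _ h1 h2 (by simpa using hc1) (by simpa using hc2)
    · have : π.symm x ∈ Y := by simpa [hY] using hx
      exact ⟨π.symm x, ⟨Y.min'_le _ this, Y.le_max' _ this⟩, by simp⟩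

theorem edgeIntervals_permGraph {k : ℕ} (π : Equiv.Perm (Fin (k - 1))) (a b : ℕ) :
    edgeIntervals (permGraph k π) a b ↔ PosInterval (k - 1) (pos π) a b := by
  have key : ∀ (ha : a < k) (hb : b < k), a < b → ((permGraph k π).Adj ⟨a, ha⟩ ⟨b, hb⟩ ↔
      PosInterval (k - 1) (pos π) a b) := by
    intro ha hb hab
    rw [permGraph, SimpleGraph.fromRel_adj]
    simp only [ne_eq, Fin.mk.injEq, Fin.mk_lt_mk]
    have hne : {v : Fin (k - 1) | a ≤ v.val ∧ v.val < b}.Nonempty :=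
      ⟨⟨a, by omega⟩, le_rfl, hab⟩
    rw [isContiguous_iff π hne]
    constructor
    · rintro ⟨-, ⟨-, h⟩ | ⟨h, -⟩⟩
      · refine ⟨hab, by omega, fun x y z x1 x2 z1 z2 y1 y2 y3 => ?_⟩
        refine h ⟨x, by omega⟩ ⟨y, y1⟩ ⟨z, by omega⟩ ⟨x1, x2⟩ ⟨z1, z2⟩ ?_ ?_
        · simpa [pos, y1, show x < k - 1 by omega] using y2
        · simpa [pos, y1, show z < k - 1 by omega] using y3
      · omega
    · rintro ⟨-, h1, h2⟩
      refine ⟨by omega, .inl ⟨hab, fun x y z hx hz hxy hyz => ?_⟩⟩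
      refine h2 x y z hx.1 hx.2 hz.1 hz.2 y.2 ?_ ?_
      · simpa [pos_val] using hxy
      · simpa [pos_val] using hyz
  constructor
  · rintro ⟨ha, hb, hab, h⟩
    exact (key ha hb hab).1 h
  · intro h
    have h1 := h.1
    have h2 := h.2.1
    exact ⟨by omega, by omega, h1, (key (by omega) (by omega) h1).2 h⟩

section

variable {k : ℕ} {G : SimpleGraph (Fin k)}

theorem edgeIntervals_val {a b : Fin k} : edgeIntervals G a b ↔ a < b ∧ G.Adj a b :=
  ⟨fun ⟨_, _, h1, h2⟩ => ⟨h1, h2⟩, fun ⟨h1, h2⟩ => ⟨a.2, b.2, h1, h2⟩⟩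

theorem permGraph_eq_iff {π : Equiv.Perm (Fin (k - 1))} :
    permGraph k π = G ↔ ∀ a b, PosInterval (k - 1) (pos π) a b ↔ edgeIntervals G a b := by
  simp only [← edgeIntervals_permGraph]
  refine ⟨by rintro rfl; simp, fun h => ?_⟩
  have h' : ∀ a b : Fin k, a < b → ((permGraph k π).Adj a b ↔ G.Adj a b) := fun a b hab => by
    have := h a b
    rw [edgeIntervals_val, edgeIntervals_val] at this
    simpa [hab] using this
  ext a b
  rcases lt_trichotomy a b with hab | rfl | hab
  · exact h' a b hab
  · simp
  · rw [SimpleGraph.adj_comm, h' b a hab, SimpleGraph.adj_comm]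

/-! ### Regions and nodes -/

theorem isSide_comm {S : Finset (Fin k)} {a b : Fin k} : IsSide S a b ↔ IsSide S b a := by
  unfold IsSide
  rw [Set.uIoo_comm, Set.uIcc_comm]
  tauto

theorem isSide_iff {S : Finset (Fin k)} {a b : Fin k} (hab : a < b) :
    IsSide S a b ↔ a ∈ S ∧ b ∈ S ∧
      ((∀ c ∈ S, c ≤ a ∨ b ≤ c) ∨ (∀ c ∈ S, a ≤ c ∧ c ≤ b)) := by
  unfold IsSide
  rw [Set.uIoo_of_lt hab, Set.uIcc_of_le hab.le]
  simp only [Set.mem_Ioo, Set.mem_Icc, not_and_or, not_lt, ne_eq, hab.ne, not_false_eq_true,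
    true_and]

theorem isNonCrossingDiagonal_comm {a b : Fin k} :
    IsNonCrossingDiagonal G a b ↔ IsNonCrossingDiagonal G b a := by
  unfold IsNonCrossingDiagonal Crosses
  rw [Set.uIoo_comm, Set.uIcc_comm, isSide_comm, G.adj_comm]

/-- The sides of the polygon and the non-crossing diagonals are the strong intervals. -/
theorem isSide_or_isNonCrossingDiagonal_iff (H : IntervalSystem (k - 1) (edgeIntervals G))
    {a b : Fin k} (hab : a < b) :
    IsSide univ a b ∨ IsNonCrossingDiagonal G a b ↔ Strong (edgeIntervals G) a b := by
  have hab' : a.val < b.val := hab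
  have hbk := b.2
  constructor
  · rintro (h | ⟨h1, h2, h3⟩)
    · rw [isSide_iff hab] at h
      rcases h.2.2 with h | h
      · have h4 := h ⟨a + 1, by omega⟩ (mem_univ _)
        simp only [Fin.le_def] at h4
        rw [show b.val = a + 1 by omega]
        exact H.strong_unit (by omega)
      · have h4 := h ⟨0, by omega⟩ (mem_univ _)
        have h5 := h ⟨k - 1, by omega⟩ (mem_univ _)
        simp only [Fin.le_def] at h4 h5
        rw [show a.val = 0 by omega, show b.val = k - 1 by omega]
        exact H.strong_top
    · refine ⟨edgeIntervals_val.2 ⟨hab, h1⟩, ?_⟩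
      rintro c d ⟨hc, hd, hcd, h⟩
      have := h3 _ _ h
      unfold Crosses at this
      rw [Set.uIoo_of_lt hab, Set.uIcc_of_le hab.le] at this
      simp only [Set.mem_Ioo, Set.mem_Icc, Fin.lt_def, Fin.le_def] at this
      omega
  · intro hT
    by_cases hs : IsSide univ a b
    · exact .inl hs
    refine .inr ⟨(edgeIntervals_val.1 hT.1).2, hs, fun c d hcd hX => ?_⟩
    unfold Crosses at hX
    rw [Set.uIoo_of_lt hab, Set.uIcc_of_le hab.le] at hX
    simp only [Set.mem_Ioo, Set.mem_Icc, Fin.lt_def, Fin.le_def] at hX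
    rcases lt_trichotomy c d with h | rfl | h
    · have := hT.2 c d (edgeIntervals_val.2 ⟨h, hcd⟩)
      have h' : c.val < d.val := h
      omega
    · exact G.irrefl hcd
    · have := hT.2 d c (edgeIntervals_val.2 ⟨h, hcd.symm⟩)
      have h' : d.val < c.val := h
      omega

/-- `S` consists of the cut points of the node `[i, j)`. -/
def RegionAt (G : SimpleGraph (Fin k)) (S : Finset (Fin k)) (i j : ℕ) : Prop :=
  Node (edgeIntervals G) i j ∧ ∀ v : Fin k, v ∈ S ↔ Vert (edgeIntervals G) i j v

namespace RegionAt

variable {S S' : Finset (Fin k)} {i j i' j' : ℕ}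

theorem lt (H : IntervalSystem (k - 1) (edgeIntervals G)) (h : RegionAt G S i j) : j < k := by
  have := H.le h.1.1.1
  have := h.1.2
  omega

theorem node_eq (H : IntervalSystem (k - 1) (edgeIntervals G)) (h : RegionAt G S i j)
    (h' : RegionAt G S i' j') : i = i' ∧ j = j' := by
  have h1 := h.lt H
  have h2 := h'.lt H
  have h3 := h.1.2
  have h4 := h'.1.2
  have a1 := (h'.2 ⟨i, by omega⟩).1 ((h.2 _).2 (vert_left (by omega)))
  have a2 := (h'.2 ⟨j, by omega⟩).1 ((h.2 _).2 (vert_right (by omega)))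
  have a3 := (h.2 ⟨i', by omega⟩).1 ((h'.2 _).2 (vert_left (by omega)))
  have a4 := (h.2 ⟨j', by omega⟩).1 ((h'.2 _).2 (vert_right (by omega)))
  have b1 := a1.1
  have b2 := a2.2.1
  have b3 := a3.1
  have b4 := a4.2.1
  simp only at b1 b2 b3 b4
  omega

theorem eq (h : RegionAt G S i j) (h' : RegionAt G S' i j) : S = S' := by
  ext v
  rw [h.2, h'.2]

theorem isSide_iff (H : IntervalSystem (k - 1) (edgeIntervals G)) (h : RegionAt G S i j)
    {a b : Fin k} (hab : a < b) :
    IsSide S a b ↔ Block (edgeIntervals G) i j a b ∨ (a.val = i ∧ b.val = j) := by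
  have hj := h.lt H
  have hij := h.1.2
  rw [_root_.isSide_iff hab, h.2, h.2]
  constructor
  · rintro ⟨ha, hb, h1 | h1⟩
    · refine .inl ⟨ha, hb, hab, fun u hu => ?_⟩
      have hu2 := hu.2.1
      exact h1 ⟨u, by omega⟩ ((h.2 _).2 hu)
    · have h2 := h1 ⟨i, by omega⟩ ((h.2 _).2 (vert_left (by omega)))
      have h3 := h1 ⟨j, by omega⟩ ((h.2 _).2 (vert_right (by omega)))
      have := ha.1
      have := hb.2.1
      simp only [Fin.le_def] at h2 h3
      omega
  · rintro (hB | ⟨h1, h2⟩)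
    · exact ⟨hB.1, hB.2.1, .inl fun c hc => hB.2.2.2 c ((h.2 c).1 hc)⟩
    · refine ⟨h1 ▸ vert_left (by omega), h2 ▸ vert_right (by omega), .inr fun c hc => ?_⟩
      have hc := (h.2 c).1 hc
      rw [Fin.le_def, Fin.le_def, h1, h2]
      exact ⟨hc.1, hc.2.1⟩

theorem strong_of_isSide (H : IntervalSystem (k - 1) (edgeIntervals G)) (h : RegionAt G S i j)
    {a b : Fin k} (hab : a < b) (hs : IsSide S a b) : Strong (edgeIntervals G) a b := by
  rcases (h.isSide_iff H hab).1 hs with hB | ⟨h1, h2⟩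
  · exact H.block_strong h.1 hB
  · rw [h1, h2]
    exact h.1.1

theorem isRegion (H : IntervalSystem (k - 1) (edgeIntervals G)) (h : RegionAt G S i j) :
    IsRegion G S := by
  have hj := h.lt H
  refine ⟨?_, fun a b hs => ?_, fun a ha b hb hX => ?_⟩
  · obtain ⟨u, hu, h1, h2⟩ := H.exists_vert_between h.1
    have hsub : ({⟨i, by omega⟩, ⟨u, by omega⟩, ⟨j, hj⟩} : Finset (Fin k)) ⊆ S := by
      intro v hv
      simp only [mem_insert, mem_singleton] at hv
      rcases hv with rfl | rfl | rfl
      · exact (h.2 _).2 (vert_left (by omega))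
      · exact (h.2 _).2 hu
      · exact (h.2 _).2 (vert_right (by omega))
    refine le_of_eq_of_le ?_ (card_le_card hsub)
    rw [card_eq_three.2]
    exact ⟨_, _, _, by simp; omega, by simp; omega, by simp; omega, rfl⟩
  · wlog hab : a < b generalizing a b
    · have hne := hs.2.2.1
      rw [isSide_comm, isNonCrossingDiagonal_comm]
      exact this b a (isSide_comm.1 hs) (by omega)
    rw [isSide_or_isNonCrossingDiagonal_iff H hab]
    exact h.strong_of_isSide H hab hs
  · wlog hab : a < b generalizing a b
    · have hne := hX.1.ne
      exact isSide_comm.1 (this b hb a ha (isNonCrossingDiagonal_comm.1 hX) (by omega))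
    have hT := (isSide_or_isNonCrossingDiagonal_iff H hab).1 (.inr hX)
    rw [h.2] at ha hb
    rw [h.isSide_iff H hab]
    by_contra hcon
    obtain ⟨h1, h2⟩ := not_or.1 hcon
    refine h1 ⟨ha, hb, hab, fun u hu => ?_⟩
    by_contra h3
    exact h2 (hu.2.2 a b hT ha.1 hb.2.1 (by omega) (by omega))

theorem isCompleteRegion_iff (H : IntervalSystem (k - 1) (edgeIntervals G))
    (h : RegionAt G S i j) : IsCompleteRegion G S ↔ Complete (edgeIntervals G) i j := by
  constructor
  · rintro ⟨-, hc⟩ a b ha hb hab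
    have := h.lt H
    have hbj := hb.2.1
    refine ⟨by omega, by omega, hab, hc ?_ ?_ (by simp; omega)⟩
    · exact (h.2 _).2 ha
    · exact (h.2 _).2 hb
  · refine fun hC => ⟨h.isRegion H, fun a ha b hb hne => ?_⟩
    have ha := (h.2 a).1 ha
    have hb := (h.2 b).1 hb
    rcases lt_or_gt_of_ne hne with hab | hab
    · exact (edgeIntervals_val.1 (hC a b ha hb hab)).2
    · exact (edgeIntervals_val.1 (hC b a hb ha hab)).2.symm

theorem isCycleRegion_iff (H : IntervalSystem (k - 1) (edgeIntervals G))
    (h : RegionAt G S i j) : IsCycleRegion G S ↔ Cyclic (edgeIntervals G) i j := by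
  constructor
  · rintro ⟨-, hc⟩ a b ha hb hab ⟨hak, hbk, -, hE⟩
    exact (h.isSide_iff H (a := ⟨a, hak⟩) (b := ⟨b, hbk⟩) hab).1
      ((hc _ ((h.2 _).2 ha) _ ((h.2 _).2 hb)).1 hE)
  · refine fun hC => ⟨h.isRegion H, fun a ha b hb => ?_⟩
    wlog hab : a < b generalizing a b
    · rcases eq_or_ne a b with rfl | hne
      · simp [IsSide]
      · rw [isSide_comm, G.adj_comm]
        exact this b hb a ha (by omega)
    have ha := (h.2 a).1 ha
    have hb := (h.2 b).1 hb
    refine ⟨fun hE => (h.isSide_iff H hab).2 (hC a b ha hb hab (edgeIntervals_val.2 ⟨hab, hE⟩)),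
      fun hs => (edgeIntervals_val.1 (h.strong_of_isSide H hab hs).1).2⟩

end RegionAt

theorem IsRegion.exists_regionAt (H : IntervalSystem (k - 1) (edgeIntervals G))
    {S : Finset (Fin k)} (h : IsRegion G S) : ∃ i j, RegionAt G S i j := by
  classical
  obtain ⟨hcard, hside, hdiag⟩ := h
  have hne : S.Nonempty := card_pos.1 (by omega)
  obtain ⟨i, hi⟩ : ∃ i, i = S.min' hne := ⟨_, rfl⟩
  obtain ⟨j, hj⟩ : ∃ j, j = S.max' hne := ⟨_, rfl⟩
  have hiS : i ∈ S := hi ▸ S.min'_mem hne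
  have hjS : j ∈ S := hj ▸ S.max'_mem hne
  have hile : ∀ v ∈ S, i ≤ v := fun v hv => hi ▸ S.min'_le v hv
  have hlej : ∀ v ∈ S, v ≤ j := fun v hv => hj ▸ S.le_max' v hv
  obtain ⟨u, huS, hui, huj⟩ : ∃ u ∈ S, u ≠ i ∧ u ≠ j := by
    by_contra hcon
    push Not at hcon
    have : S ⊆ {i, j} := fun v hv => by
      simp only [mem_insert, mem_singleton]
      by_cases hvi : v = i
      · exact .inl hvi
      · exact .inr (hcon v hv hvi)
    have := (card_le_card this).trans card_le_two
    omega
  have hiu : i < u := lt_of_le_of_ne (hile u huS) hui.symm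
  have huj : u < j := lt_of_le_of_ne (hlej u huS) huj
  have hsideT : ∀ a b : Fin k, a < b → IsSide S a b → Strong (edgeIntervals G) a b :=
    fun a b hab hs => (isSide_or_isNonCrossingDiagonal_iff H hab).1 (hside a b hs)
  have hTside : ∀ a b : Fin k, a < b → a ∈ S → b ∈ S → Strong (edgeIntervals G) a b →
      IsSide S a b := by
    intro a b hab ha hb hT
    rcases (isSide_or_isNonCrossingDiagonal_iff H hab).2 hT with hs | hX
    · rw [isSide_iff hab] at hs ⊢
      exact ⟨ha, hb, hs.2.2.imp (fun h c _ => h c (mem_univ c)) (fun h c _ => h c (mem_univ c))⟩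
    · exact hdiag a ha b hb hX
  have hTij : Strong (edgeIntervals G) i j := hsideT i j (hiu.trans huj)
    ((isSide_iff (hiu.trans huj)).2 ⟨hiS, hjS, .inr fun c hc => ⟨hile c hc, hlej c hc⟩⟩)
  -- Each `c` with `i ≤ c < j` lies between two consecutive vertices of the region.
  have hcons : ∀ c : Fin k, i ≤ c → c < j → ∃ a b, a ∈ S ∧ b ∈ S ∧ a ≤ c ∧ c < b ∧
      (∀ v ∈ S, v ≤ a ∨ b ≤ v) ∧ Strong (edgeIntervals G) a b := by
    intro c hic hcj
    have h1 : {v ∈ S | v ≤ c}.Nonempty := ⟨i, by simp [hiS, hic]⟩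
    have h2 : {v ∈ S | c < v}.Nonempty := ⟨j, by simp [hjS, hcj]⟩
    have h3 := max'_mem _ h1
    have h4 := min'_mem _ h2
    have h5 : ∀ v ∈ S, v ≤ c → v ≤ max' _ h1 := fun v hv hvc => le_max' _ v (by simp [hv, hvc])
    have h6 : ∀ v ∈ S, c < v → min' _ h2 ≤ v := fun v hv hvc => min'_le _ v (by simp [hv, hvc])
    generalize max' _ h1 = a at h3 h5
    generalize min' _ h2 = b at h4 h6
    simp only [mem_filter] at h3 h4
    have h7 : ∀ v ∈ S, v ≤ a ∨ b ≤ v := fun v hv => by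
      rcases le_or_gt v c with h | h
      · exact .inl (h5 v hv h)
      · exact .inr (h6 v hv h)
    have hab : a < b := h3.2.trans_lt h4.2
    exact ⟨a, b, h3.1, h4.1, h3.2, h4.2, h7, hsideT a b hab
      ((isSide_iff hab).2 ⟨h3.1, h4.1, .inl h7⟩)⟩
  refine ⟨i, j, ⟨hTij, by omega⟩, fun v => ⟨fun hv => ⟨hile v hv, hlej v hv, ?_⟩, fun hv => ?_⟩⟩
  · intro c d hT hic hdj hcv hvd
    have hcd := H.lt hT.1
    have hdk := d.lt_or_ge k
    have hjk := j.2
    obtain ⟨a, b, ha, hb, hac, hcb, hab, hTab⟩ := hcons ⟨c, by omega⟩ hic (by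
      rw [Fin.lt_def]; simp only; omega)
    obtain ⟨a', b', ha', hb', hac', hcb', hab', hTab'⟩ := hcons ⟨d - 1, by omega⟩ (by
      rw [Fin.le_def]; simp only; omega) (by rw [Fin.lt_def]; simp only; omega)
    rw [Fin.le_def] at hac hac'
    rw [Fin.lt_def] at hcb hcb'
    simp only at hac hac' hcb hcb'
    have h1 := hab v hv
    have h2 := hab' v hv
    have h3 := hT.2 _ _ hTab.1
    have h4 := hT.2 _ _ hTab'.1
    simp only [Fin.le_def] at h1 h2
    obtain rfl : a.val = c := by omega
    obtain rfl : b'.val = d := by omega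
    have hs := (isSide_iff (show a < b' from hcd)).1 (hTside a b' hcd ha hb' hT)
    rcases hs.2.2 with h | h
    · have := h v hv
      simp only [Fin.le_def] at this
      omega
    · have h5 := h i hiS
      have h6 := h j hjS
      simp only [Fin.le_def] at h5 h6
      omega
  · by_contra hvS
    have h1 := hv.1
    have h2 := hv.2.1
    have h3 : v ≠ j := fun h => hvS (h ▸ hjS)
    obtain ⟨a, b, ha, hb, hac, hcb, hab, hTab⟩ := hcons v h1 (lt_of_le_of_ne h2 h3)
    have h4 : a ≠ v := fun h => hvS (h ▸ ha)
    have h5 := hv.2.2 a b hTab (hile a ha) (hlej b hb)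
      (lt_of_le_of_ne hac fun h => h4 (Fin.ext h)) hcb
    have h6 := hab u huS
    rw [Fin.lt_def] at hiu huj
    simp only [Fin.le_def] at h6
    omega

/-- Two different complete regions share a side exactly when one is a block of the other. -/
theorem completeRegionGraph_adj_iff (H : IntervalSystem (k - 1) (edgeIntervals G))
    {R R' : {S : Finset (Fin k) // IsCompleteRegion G S}} {i j i' j' : ℕ}
    (h : RegionAt G R.val i j) (h' : RegionAt G R'.val i' j') :
    (completeRegionGraph G).Adj R R' ↔
      Block (edgeIntervals G) i j i' j' ∨ Block (edgeIntervals G) i' j' i j := by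
  have hlt := h.lt H
  have hlt' := h'.lt H
  have hij := h.1.2
  have hij' := h'.1.2
  have hadj : (completeRegionGraph G).Adj R R' ↔
      R ≠ R' ∧ ∃ a b : Fin k, a < b ∧ IsSide R.val a b ∧ IsSide R'.val a b := by
    rw [completeRegionGraph, SimpleGraph.fromRel_adj]
    refine and_congr_right fun _ => ⟨?_, ?_⟩
    · have key : ∀ a b : Fin k, IsSide R.val a b → IsSide R'.val a b →
          ∃ a b : Fin k, a < b ∧ IsSide R.val a b ∧ IsSide R'.val a b := by
        intro a b h1 h2
        rcases lt_or_gt_of_ne h1.2.2.1 with hab | hab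
        · exact ⟨a, b, hab, h1, h2⟩
        · exact ⟨b, a, hab, isSide_comm.1 h1, isSide_comm.1 h2⟩
      rintro (⟨a, b, h1, h2⟩ | ⟨a, b, h1, h2⟩)
      · exact key a b h1 h2
      · exact key a b h2 h1
    · rintro ⟨a, b, -, h1, h2⟩
      exact .inl ⟨a, b, h1, h2⟩
  rw [hadj]
  constructor
  · rintro ⟨hne, a, b, hab, h1, h2⟩
    rw [h.isSide_iff H hab] at h1
    rw [h'.isSide_iff H hab] at h2
    rcases h1 with h1 | ⟨rfl, rfl⟩ <;> rcases h2 with h2 | ⟨h2, h3⟩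
    · obtain ⟨rfl, rfl⟩ := H.parent_unique h.1 h'.1 h1 h2
      exact absurd (Subtype.ext (h.eq h')) hne
    · subst h2 h3
      exact .inl h1
    · exact .inr h2
    · subst h2 h3
      exact absurd (Subtype.ext (h.eq h')) hne
  · intro hB
    refine ⟨?_, ?_⟩
    · rintro rfl
      obtain ⟨rfl, rfl⟩ := h.node_eq H h'
      rcases hB with hB | hB <;> exact (H.block_strong_and_ne h.1 hB).2 ⟨rfl, rfl⟩
    · rcases hB with hB | hB
      · have hab : (⟨i', by omega⟩ : Fin k) < ⟨j', hlt'⟩ := by simp; omega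
        exact ⟨_, _, hab, (h.isSide_iff H hab).2 (.inl hB), (h'.isSide_iff H hab).2
          (.inr ⟨rfl, rfl⟩)⟩
      · have hab : (⟨i, by omega⟩ : Fin k) < ⟨j, hlt⟩ := by simp; omega
        exact ⟨_, _, hab, (h.isSide_iff H hab).2 (.inr ⟨rfl, rfl⟩), (h'.isSide_iff H hab).2
          (.inl hB)⟩

end

/-! ### The order of the blocks of a region as a permutation -/

theorem perm_eq_of_symm_lt {m : ℕ} {σ τ : Equiv.Perm (Fin m)}
    (h : ∀ s t, σ.symm s < σ.symm t → τ.symm s < τ.symm t) : σ = τ := by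
  have h1 : StrictMono (σ.trans τ.symm) := fun x y hxy => h _ _ (by simpa using hxy)
  ext x
  have h3 : τ.symm (σ x) = x := congrFun h1.eq_id x
  rw [Equiv.symm_apply_eq] at h3
  rw [h3]

theorem sort_symm_lt_iff {m : ℕ} {f : Fin m → ℤ} (hf : Function.Injective f) {s t : Fin m} :
    (Tuple.sort f).symm s < (Tuple.sort f).symm t ↔ f s < f t := by
  have h := ((Tuple.monotone_sort f).strictMono_of_injective
    (hf.comp (Tuple.sort f).injective)).lt_iff_lt (a := (Tuple.sort f).symm s)
    (b := (Tuple.sort f).symm t)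
  simpa using h.symm

section

variable {k : ℕ}

/-- The vertices of a region except the last one, in increasing order. They are the left endpoints
of the blocks. -/
def blockStart (S : Finset (Fin k)) (t : Fin (S.card - 1)) : ℕ :=
  (S.orderEmbOfFin rfl (Fin.castLE (Nat.sub_le _ _) t) : Fin k)

/-- The permutation formed by the blocks of a region, numbered by value, when they are arranged by
the positions of their left endpoints. -/
noncomputable def pattern (S : Finset (Fin k)) (p : ℕ → ℤ) : Equiv.Perm (Fin (S.card - 1)) :=
  Tuple.sort fun t => p (blockStart S t)

/-- The blocks of a region are arranged in increasing order. -/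
def Ascending (p : ℕ → ℤ) (S : Finset (Fin k)) : Prop :=
  ∀ a ∈ S, ∀ b ∈ S, a < b → (∃ c ∈ S, b < c) → p a < p b

variable {G : SimpleGraph (Fin k)} {S : Finset (Fin k)} {i j : ℕ}

namespace RegionAt

theorem ascending_iff (H : IntervalSystem (k - 1) (edgeIntervals G)) (h : RegionAt G S i j)
    {p : ℕ → ℤ} : Ascending p S ↔ Inc (edgeIntervals G) p i j := by
  have hj := h.lt H
  constructor
  · intro hA a b ha hb hab hbj
    exact hA ⟨a, by omega⟩ ((h.2 _).2 ha) ⟨b, by omega⟩ ((h.2 _).2 hb) hab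
      ⟨⟨j, hj⟩, (h.2 _).2 (vert_right (by have := h.1.2; omega)), hbj⟩
  · rintro hI a ha b hb hab ⟨c, hc, hbc⟩
    have := ((h.2 c).1 hc).2.1
    exact hI a b ((h.2 a).1 ha) ((h.2 b).1 hb) hab (by omega)

/-- The cut points of a region, listed in increasing order. -/
theorem exists_enum (H : IntervalSystem (k - 1) (edgeIntervals G)) (h : RegionAt G S i j) :
    ∃ g : ℕ → ℕ, (∀ s t, s ≤ S.card - 1 → t ≤ S.card - 1 → (g s < g t ↔ s < t)) ∧
      (∀ v, Vert (edgeIntervals G) i j v ↔ ∃ t, t ≤ S.card - 1 ∧ g t = v) ∧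
      (∀ t : Fin (S.card - 1), g t = blockStart S t) ∧ g 0 = i ∧ g (S.card - 1) = j := by
  have hj := h.lt H
  have hij := h.1.2
  have hcard := (h.isRegion H).1
  set g : ℕ → ℕ := fun t => if ht : t < S.card then (S.orderEmbOfFin rfl ⟨t, ht⟩ : Fin k) else 0
    with hg
  have hmono : ∀ s t, s ≤ S.card - 1 → t ≤ S.card - 1 → (g s < g t ↔ s < t) := by
    intro s t hs ht
    simp only [hg, show s < S.card by omega, show t < S.card by omega, dite_true]
    rw [← Fin.lt_def, OrderEmbedding.lt_iff_lt, Fin.mk_lt_mk]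
  have hvert : ∀ v, Vert (edgeIntervals G) i j v ↔ ∃ t, t ≤ S.card - 1 ∧ g t = v := by
    intro v
    constructor
    · intro hv
      have hvj := hv.2.1
      have hvS : (⟨v, by omega⟩ : Fin k) ∈ S := (h.2 _).2 hv
      rw [← mem_coe, ← S.range_orderEmbOfFin rfl] at hvS
      obtain ⟨t, ht⟩ := hvS
      refine ⟨t, by omega, ?_⟩
      simp [hg, ht]
    · rintro ⟨t, ht, rfl⟩
      simp only [hg, show t < S.card by omega, dite_true]
      exact (h.2 _).1 (S.orderEmbOfFin_mem rfl _)
  refine ⟨g, hmono, hvert, fun t => ?_, ?_, ?_⟩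
  · simp only [hg, show t.val < S.card by omega, dite_true, blockStart]
    rfl
  · obtain ⟨t, ht, hti⟩ := (hvert i).1 (vert_left (by omega))
    have h1 := ((hvert (g 0)).2 ⟨0, by omega, rfl⟩).1
    have h2 := hmono 0 t (by omega) ht
    have h3 : t = 0 := by omega
    exact h3 ▸ hti
  · obtain ⟨t, ht, hti⟩ := (hvert j).1 (vert_right (by omega))
    have h1 := ((hvert (g (S.card - 1))).2 ⟨_, le_rfl, rfl⟩).2.1
    have h2 := hmono t (S.card - 1) ht le_rfl
    have h3 : t = S.card - 1 := by omega
    exact h3 ▸ hti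

theorem vert_iff (H : IntervalSystem (k - 1) (edgeIntervals G)) (h : RegionAt G S i j) {v : ℕ} :
    Vert (edgeIntervals G) i j v ∧ v < j ↔ ∃ t, blockStart S t = v := by
  have hcard := (h.isRegion H).1
  obtain ⟨g, hg, hv, hb, h0, h1⟩ := h.exists_enum H
  constructor
  · rintro ⟨h2, h3⟩
    obtain ⟨t, ht, rfl⟩ := (hv v).1 h2
    have := hg t (S.card - 1) ht le_rfl
    exact ⟨⟨t, by omega⟩, (hb _).symm⟩
  · rintro ⟨t, rfl⟩
    have := hg t (S.card - 1) (by omega) le_rfl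
    have := hb t
    exact ⟨(hv _).2 ⟨t, by omega, hb t⟩, by omega⟩

theorem blockStart_injective : Function.Injective (blockStart S) := by
  intro s t hst
  have := (S.orderEmbOfFin rfl).injective (Fin.ext hst)
  simpa using this

theorem pattern_symm_lt (H : IntervalSystem (k - 1) (edgeIntervals G)) (h : RegionAt G S i j)
    {p : ℕ → ℤ} (hp : ∀ v v', Vert (edgeIntervals G) i j v → Vert (edgeIntervals G) i j v' →
      v < j → v' < j → p v = p v' → v = v') {s t : Fin (S.card - 1)} :
    (pattern S p).symm s < (pattern S p).symm t ↔ p (blockStart S s) < p (blockStart S t) := by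
  refine sort_symm_lt_iff (f := fun t => p (blockStart S t)) fun s t hst => ?_
  have hs := (h.vert_iff H).2 ⟨s, rfl⟩
  have ht := (h.vert_iff H).2 ⟨t, rfl⟩
  exact blockStart_injective (hp _ _ hs.1 ht.1 hs.2 ht.2 hst)

/-- The permutation formed by the blocks of a region is simple if and only if no union of at least
two consecutive blocks, other than the whole, is contiguous. -/
theorem isSimplePerm_iff (H : IntervalSystem (k - 1) (edgeIntervals G)) (h : RegionAt G S i j)
    {q : ℕ → ℤ} {σ : Equiv.Perm (Fin (S.card - 1))}
    (hσ : ∀ s t, σ.symm s < σ.symm t ↔ q (blockStart S s) < q (blockStart S t)) :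
    IsSimplePerm σ ↔ ∀ a b, Vert (edgeIntervals G) i j a → Vert (edgeIntervals G) i j b →
      a < b → BlockInterval (edgeIntervals G) q i j a b →
      Block (edgeIntervals G) i j a b ∨ (a = i ∧ b = j) := by
  have hcard := (h.isRegion H).1
  obtain ⟨g, hg, hv, hb, h0, h1⟩ := h.exists_enum H
  simp only [← hb] at hσ
  constructor
  · intro hs a b ha hb hab hP
    have hbj := hb.2.1
    obtain ⟨s, hs', rfl⟩ := (hv a).1 ha
    obtain ⟨t, ht', rfl⟩ := (hv b).1 hb
    rw [hg s t hs' ht'] at hab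
    by_contra hcon
    obtain ⟨hc1, hc2⟩ := not_or.1 hcon
    have hst : s + 1 < t := by
      by_contra hle
      obtain rfl : t = s + 1 := by omega
      refine hc1 ⟨ha, hb, by rw [hg _ _ hs' ht']; omega, fun u hu => ?_⟩
      obtain ⟨r, hr, rfl⟩ := (hv u).1 hu
      have e1 := hg s r hs' hr
      have e2 := hg r (s + 1) hr ht'
      omega
    have hwhole : ¬(s = 0 ∧ t = S.card - 1) := by
      rintro ⟨rfl, rfl⟩
      exact hc2 ⟨h0, h1⟩
    refine hs ⟨s, by omega⟩ ⟨t - 1, by omega⟩ (by rw [Fin.card_Icc]; simp only; omega)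
      (by rw [Fin.card_Icc]; simp only; omega) ?_
    have hne : (Set.Icc (⟨s, by omega⟩ : Fin (S.card - 1)) ⟨t - 1, by omega⟩).Nonempty :=
      ⟨⟨s, by omega⟩, le_rfl, by rw [Fin.le_def]; simp only; omega⟩
    rw [isContiguous_iff _ hne]
    intro x y z hx hz hxy hyz
    rw [hσ] at hxy hyz
    simp only [Set.mem_Icc, Fin.le_def] at hx hz ⊢
    have e1 := hg x t (by omega) ht'
    have e2 := hg x s (by omega) hs'
    have e3 := hg z t (by omega) ht'
    have e4 := hg z s (by omega) hs'
    have e5 := hg y t (by omega) ht'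
    have e6 := hg y s (by omega) hs'
    have e7 := hg y (S.card - 1) (by omega) le_rfl
    have := hP (g x) (g y) (g z) ((hv _).2 ⟨x, by omega, rfl⟩) ((hv _).2 ⟨y, by omega, rfl⟩)
      ((hv _).2 ⟨z, by omega, rfl⟩) (by omega) (by omega) (by omega) (by omega) (by omega) hxy hyz
    omega
  · intro hP c d hc1 hc2 hcon
    rw [Fin.card_Icc] at hc1 hc2
    have hne : (Set.Icc c d).Nonempty := ⟨c, le_rfl, by rw [Fin.le_def]; omega⟩
    rw [isContiguous_iff _ hne] at hcon
    have hK : ∀ t, t ≤ S.card - 1 → Vert (edgeIntervals G) i j (g t) :=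
      fun t ht => (hv _).2 ⟨t, ht, rfl⟩
    have hBI : BlockInterval (edgeIntervals G) q i j (g c) (g (d + 1)) := by
      intro x y z hx hy hz hyj x1 x2 z1 z2 y1 y2
      obtain ⟨x, hx', rfl⟩ := (hv x).1 hx
      obtain ⟨y, hy', rfl⟩ := (hv y).1 hy
      obtain ⟨z, hz', rfl⟩ := (hv z).1 hz
      have e1 := hg x (d + 1) hx' (by omega)
      have e2 := hg x c hx' (by omega)
      have e3 := hg z (d + 1) hz' (by omega)
      have e4 := hg z c hz' (by omega)
      have e5 := hg y (d + 1) hy' (by omega)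
      have e6 := hg y c hy' (by omega)
      have e7 := hg y (S.card - 1) hy' le_rfl
      have := hcon ⟨x, by omega⟩ ⟨y, by omega⟩ ⟨z, by omega⟩
        ⟨by rw [Fin.le_def]; simp only; omega, by rw [Fin.le_def]; simp only; omega⟩
        ⟨by rw [Fin.le_def]; simp only; omega, by rw [Fin.le_def]; simp only; omega⟩
        ((hσ _ _).2 y1) ((hσ _ _).2 y2)
      simp only [Set.mem_Icc, Fin.le_def] at this
      omega
    have e1 := hg c (d + 1) (by omega) (by omega)
    rcases hP _ _ (hK c (by omega)) (hK (d + 1) (by omega)) (by omega) hBI with hB | ⟨h2, h3⟩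
    · have := hB.2.2.2 _ (hK (c + 1) (by omega))
      have e2 := hg c (c + 1) (by omega) (by omega)
      have e3 := hg (c + 1) (d + 1) (by omega) (by omega)
      omega
    · have e2 := hg 0 c (by omega) (by omega)
      have e3 := hg (d + 1) (S.card - 1) (by omega) (by omega)
      omega

/-- A triangle is both complete and a cycle, but a cycle with at least five vertices is not
complete. -/
theorem not_complete_of_cyclic (H : IntervalSystem (k - 1) (edgeIntervals G))
    (h : RegionAt G S i j) (hC : Cyclic (edgeIntervals G) i j) (hS : 5 ≤ S.card) :
    ¬ Complete (edgeIntervals G) i j := by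
  intro hC'
  obtain ⟨g, hg, hv, hb, h0, h1⟩ := h.exists_enum H
  have hK : ∀ t, t ≤ S.card - 1 → Vert (edgeIntervals G) i j (g t) :=
    fun t ht => (hv _).2 ⟨t, ht, rfl⟩
  have e1 := hg 0 2 (by omega) (by omega)
  have e2 := hg 0 1 (by omega) (by omega)
  have e3 := hg 1 2 (by omega) (by omega)
  have e4 := hg 2 (S.card - 1) (by omega) (by omega)
  rcases hC _ _ (hK 0 (by omega)) (hK 2 (by omega)) (by omega)
    (hC' _ _ (hK 0 (by omega)) (hK 2 (by omega)) (by omega)) with hB | hB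
  · have := hB.2.2.2 _ (hK 1 (by omega))
    omega
  · omega

theorem cyclic_of_not_complete (H : IntervalSystem (k - 1) (edgeIntervals G))
    (h : RegionAt G S i j) {p : ℕ → ℤ} (R : Realizes (k - 1) (edgeIntervals G) p)
    (hC : ¬ Complete (edgeIntervals G) i j) : Cyclic (edgeIntervals G) i j ∧ 5 ≤ S.card := by
  refine ⟨(H.complete_or_cyclic h.1).resolve_left hC, ?_⟩
  obtain ⟨u, v, w, hu, hv', hw, h2, h3, h4, h5⟩ := R.exists_five_verts H h.1 hC
  obtain ⟨g, hg, hv, hb, h0, h1⟩ := h.exists_enum H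
  obtain ⟨a, ha, rfl⟩ := (hv _).1 hu
  obtain ⟨b, hb, rfl⟩ := (hv _).1 hv'
  obtain ⟨c, hc, rfl⟩ := (hv _).1 hw
  have e1 := hg 0 a (by omega) ha
  have e2 := hg a b ha hb
  have e3 := hg b c hb hc
  have e4 := hg c (S.card - 1) hc le_rfl
  omega

end RegionAt

theorem Node.exists_regionAt (hN : Node (edgeIntervals G) i j) : ∃ S, RegionAt G S i j := by
  classical
  exact ⟨({v : Fin k | Vert (edgeIntervals G) i j v} : Finset (Fin k)), hN, by simp⟩

/-- Complete regions sharing a side are arranged in opposite directions. -/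
theorem ascending_iff_not_of_adj (H : IntervalSystem (k - 1) (edgeIntervals G)) {p : ℕ → ℤ}
    (R : Realizes (k - 1) (edgeIntervals G) p) {A B : {S : Finset (Fin k) // IsCompleteRegion G S}}
    (hAB : (completeRegionGraph G).Adj A B) : Ascending p A.val ↔ ¬ Ascending p B.val := by
  obtain ⟨i, j, hA⟩ := A.2.1.exists_regionAt H
  obtain ⟨i', j', hB⟩ := B.2.1.exists_regionAt H
  rw [hA.ascending_iff H, hB.ascending_iff H]
  have hCA := (hA.isCompleteRegion_iff H).1 A.2
  have hCB := (hB.isCompleteRegion_iff H).1 B.2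
  rcases (completeRegionGraph_adj_iff H hA hB).1 hAB with h | h
  · exact R.inc_iff_not_inc H hA.1 hCA h hB.1 hCB
  · have := R.inc_iff_not_inc H hB.1 hCB h hA.1 hCA
    tauto

theorem SimpleGraph.Reachable.iff_of_adj {V : Type*} {Γ : SimpleGraph V} {P : V → Prop}
    (hP : ∀ a b, Γ.Adj a b → (P a ↔ P b)) {a b : V} (h : Γ.Reachable a b) : P a ↔ P b := by
  obtain ⟨w⟩ := h
  induction w with
  | nil => rfl
  | cons hadj _ ih => exact (hP _ _ hadj).trans ih

/-- The directions of the complete regions in two arrangements either agree on a whole component of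
complete regions or are opposite on it. -/
theorem ascending_iff_of_reachable (H : IntervalSystem (k - 1) (edgeIntervals G)) {p q : ℕ → ℤ}
    (R : Realizes (k - 1) (edgeIntervals G) p) (Q : Realizes (k - 1) (edgeIntervals G) q)
    {A B : {S : Finset (Fin k) // IsCompleteRegion G S}}
    (hAB : (completeRegionGraph G).Reachable A B) :
    (Ascending p A.val ↔ Ascending q A.val) ↔ (Ascending p B.val ↔ Ascending q B.val) := by
  refine hAB.iff_of_adj (P := fun C => (Ascending p C.val ↔ Ascending q C.val))
    fun C C' hCC' => ?_
  have h1 := ascending_iff_not_of_adj H R hCC'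
  have h2 := ascending_iff_not_of_adj H Q hCC'
  simp only [h1, h2, not_iff_not]

end

section

variable {k : ℕ} {G : SimpleGraph (Fin k)}

/-! ### Prescribing the order of the blocks of a single region -/

/-- The condition on `q`, an arrangement of the blocks of `[i, j)`, that the blocks have
distinct positions and the contiguous unions of consecutive blocks are as prescribed by `E`. -/
def LocallyRealizes (E : ℕ → ℕ → Prop) (i j : ℕ) (q : ℕ → ℤ) : Prop :=
  (∀ v v', Vert E i j v → Vert E i j v' → v < j → v' < j → q v = q v' → v = v') ∧
    ∀ a b, Vert E i j a → Vert E i j b → a < b → (BlockInterval E q i j a b ↔ E a b)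

theorem Complete.locallyRealizes {E : ℕ → ℕ → Prop} {i j : ℕ} (hC : Complete E i j) :
    LocallyRealizes E i j (fun v => (v : ℤ)) ∧ LocallyRealizes E i j (fun v => -(v : ℤ)) := by
  refine ⟨⟨fun v v' _ _ _ _ h => by simpa using h, fun a b ha hb hab =>
    ⟨fun _ => hC a b ha hb hab, fun _ x y z _ _ _ _ x1 x2 z1 z2 y1 y2 => ?_⟩⟩,
    ⟨fun v v' _ _ _ _ h => by simpa using h, fun a b ha hb hab =>
    ⟨fun _ => hC a b ha hb hab, fun _ x y z _ _ _ _ x1 x2 z1 z2 y1 y2 => ?_⟩⟩⟩ <;>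
  · dsimp only at y1 y2
    omega

/-- The blocks of a cyclic region can be arranged according to any simple permutation. -/
theorem RegionAt.exists_locallyRealizes {S : Finset (Fin k)} {i j : ℕ}
    (H : IntervalSystem (k - 1) (edgeIntervals G)) (h : RegionAt G S i j)
    (hC : Cyclic (edgeIntervals G) i j) {σ : Equiv.Perm (Fin (S.card - 1))}
    (hσ : IsSimplePerm σ) :
    ∃ q, LocallyRealizes (edgeIntervals G) i j q ∧
      ∀ s t, σ.symm s < σ.symm t ↔ q (blockStart S s) < q (blockStart S t) := by
  set q : ℕ → ℤ := Function.extend (blockStart S) (fun t => ((σ.symm t : Fin _) : ℕ)) 0 with hq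
  have hqt : ∀ t, q (blockStart S t) = ((σ.symm t : Fin _) : ℕ) := fun t => by
    rw [hq, RegionAt.blockStart_injective.extend_apply]
  have hlt : ∀ s t, σ.symm s < σ.symm t ↔ q (blockStart S s) < q (blockStart S t) := by
    intro s t
    rw [hqt, hqt, Nat.cast_lt, Fin.lt_def]
  refine ⟨q, ⟨fun v v' hv hv' hvj hvj' hqq => ?_, fun a b ha hb hab =>
    ⟨fun hP => ?_, fun hE => ?_⟩⟩, hlt⟩
  · obtain ⟨s, rfl⟩ := (h.vert_iff H).1 ⟨hv, hvj⟩
    obtain ⟨t, rfl⟩ := (h.vert_iff H).1 ⟨hv', hvj'⟩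
    rw [hqt, hqt, Nat.cast_inj, ← Fin.ext_iff, EmbeddingLike.apply_eq_iff_eq] at hqq
    rw [hqq]
  · rcases (h.isSimplePerm_iff H hlt).1 hσ a b ha hb hab hP with hB | ⟨rfl, rfl⟩
    · exact (H.block_strong h.1 hB).1
    · exact h.1.1.1
  · intro x y z hx hy hz hyj x1 x2 z1 z2 y1 y2
    rcases hC a b ha hb hab hE with hB | ⟨rfl, rfl⟩
    · have e1 := hB.2.2.2 x hx
      have e2 := hB.2.2.2 z hz
      obtain rfl : x = a := by omega
      obtain rfl : z = x := by omega
      omega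
    · exact ⟨hy.1, hyj⟩

/-! ### Counting -/

theorem permGraph_realizes {π : Equiv.Perm (Fin (k - 1))}
    (H : IntervalSystem (k - 1) (edgeIntervals G))
    (hπ : permGraph k π = G) : Realizes (k - 1) (edgeIntervals G) (pos π) :=
  realizes_posInterval H (pos_inj π) (permGraph_eq_iff.1 hπ)

/-- The blocks of a cycle are arranged as a simple permutation. -/
theorem isSimplePerm_pattern (H : IntervalSystem (k - 1) (edgeIntervals G)) {p : ℕ → ℤ}
    (R : Realizes (k - 1) (edgeIntervals G) p) {S : Finset (Fin k)} (hS : IsCycleRegion G S) :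
    IsSimplePerm (pattern S p) := by
  obtain ⟨i, j, h⟩ := hS.1.exists_regionAt H
  have hjn := H.le h.1.1.1
  have hC := (h.isCycleRegion_iff H).1 hS
  rw [h.isSimplePerm_iff H fun s t => h.pattern_symm_lt H fun v v' _ _ hv hv' =>
    R.inj v v' (by omega) (by omega)]
  intro a b ha hb hab hP
  rw [← R.posInterval_iff H h.1 ha hb hab, R.chord h.1 ha hb hab] at hP
  exact hC a b ha hb hab hP

/-- The order of the blocks at each region is determined by the patterns of the cycles with at
least five vertices and the directions of the complete regions; hence so is the permutation. -/
theorem eq_of_pattern_eq {π τ : Equiv.Perm (Fin (k - 1))}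
    (H : IntervalSystem (k - 1) (edgeIntervals G)) (hπ : permGraph k π = G)
    (hτ : permGraph k τ = G)
    (hcyc : ∀ S, IsCycleRegion G S → 5 ≤ S.card → pattern S (pos π) = pattern S (pos τ))
    (hcomp : ∀ S, IsCompleteRegion G S → (Ascending (pos π) S ↔ Ascending (pos τ) S)) :
    π = τ := by
  have R := permGraph_realizes H hπ
  have Q := permGraph_realizes H hτ
  refine perm_eq_of_symm_lt fun x y hxy => ?_
  have hlt : pos π x < pos π y := by
    rw [pos_val, pos_val, Nat.cast_lt]
    exact hxy
  have := R.order_le H Q.toRespects (fun i j v v' hN hv hv' hvj hvj' hvv' => ?_) x.2 y.2 hlt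
  · rwa [pos_val, pos_val, Nat.cast_lt] at this
  obtain ⟨S, hS⟩ := hN.exists_regionAt
  have hjn := H.le hN.1.1
  by_cases hC : Complete (edgeIntervals G) i j
  · have hI := hcomp S ((hS.isCompleteRegion_iff H).2 hC)
    rw [hS.ascending_iff H, hS.ascending_iff H] at hI
    by_cases h1 : Inc (edgeIntervals G) (pos π) i j
    · have h2 := hI.1 h1
      rcases lt_trichotomy v v' with h | rfl | h
      · exact h2 v v' hv hv' h hvj'
      · omega
      · have := h1 v' v hv' hv h hvj
        omega
    · have h2 := (Q.inc_or_dec H hN hC).resolve_left (fun h => h1 (hI.2 h))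
      have h1 := (R.inc_or_dec H hN hC).resolve_left h1
      rcases lt_trichotomy v v' with h | rfl | h
      · have := neg_lt_neg_iff.1 (h1 v v' hv hv' h hvj')
        omega
      · omega
      · exact neg_lt_neg_iff.1 (h2 v' v hv' hv h hvj)
  · obtain ⟨hY, h5⟩ := hS.cyclic_of_not_complete H R hC
    have hpat := hcyc S ((hS.isCycleRegion_iff H).2 hY) h5
    obtain ⟨s, rfl⟩ := (hS.vert_iff H).1 ⟨hv, hvj⟩
    obtain ⟨t, rfl⟩ := (hS.vert_iff H).1 ⟨hv', hvj'⟩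
    rw [← hS.pattern_symm_lt H fun v v' _ _ hv hv' => Q.inj v v' (by omega) (by omega), ← hpat,
      hS.pattern_symm_lt H fun v v' _ _ hv hv' => R.inj v v' (by omega) (by omega)]
    exact hvv'

/-- Simple patterns of the cycles with at least five vertices and directions of the complete
regions can be prescribed, as long as complete regions sharing a side get opposite
directions. -/
theorem exists_perm_of_pattern {p₀ : ℕ → ℤ} (H : IntervalSystem (k - 1) (edgeIntervals G))
    (R₀ : Realizes (k - 1) (edgeIntervals G) p₀)
    (σ : ∀ S : {S : Finset (Fin k) // IsCycleRegion G S ∧ 5 ≤ S.card},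
      Equiv.Perm (Fin (S.val.card - 1))) (hσ : ∀ S, IsSimplePerm (σ S))
    (up : {S : Finset (Fin k) // IsCompleteRegion G S} → Prop)
    (hup : ∀ A B, (completeRegionGraph G).Adj A B → (up A ↔ ¬ up B)) :
    ∃ π : Equiv.Perm (Fin (k - 1)), permGraph k π = G ∧
      (∀ S, pattern S.val (pos π) = σ S) ∧ ∀ A, Ascending (pos π) A.val ↔ up A := by
  classical
  have hloc : ∀ i j, ∃ q, Node (edgeIntervals G) i j →
      LocallyRealizes (edgeIntervals G) i j q ∧
      (∀ S, RegionAt G S.val i j → ∀ s t, (σ S).symm s < (σ S).symm t ↔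
        q (blockStart S.val s) < q (blockStart S.val t)) ∧
      (∀ A, RegionAt G A.val i j →
        (up A → Inc (edgeIntervals G) q i j) ∧
        (¬ up A → Inc (edgeIntervals G) (fun x => -q x) i j)) := by
    intro i j
    by_cases hN : Node (edgeIntervals G) i j
    swap
    · exact ⟨0, fun h => absurd h hN⟩
    obtain ⟨S, hS⟩ := hN.exists_regionAt
    by_cases hC : Complete (edgeIntervals G) i j
    · have hS' := (hS.isCompleteRegion_iff H).2 hC
      have hcyc : ∀ S : {S : Finset (Fin k) // IsCycleRegion G S ∧ 5 ≤ S.card},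
          ¬ RegionAt G S.val i j := fun S h =>
        h.not_complete_of_cyclic H ((h.isCycleRegion_iff H).1 S.2.1) S.2.2 hC
      by_cases hu : up ⟨S, hS'⟩
      · refine ⟨fun v => (v : ℤ), fun _ => ⟨hC.locallyRealizes.1, fun S h => absurd h (hcyc S),
          fun A hA => ?_⟩⟩
        obtain rfl : A = ⟨S, hS'⟩ := Subtype.ext (hA.eq hS)
        exact ⟨fun _ a b _ _ hab _ => by simpa using hab, fun h => absurd hu h⟩
      · refine ⟨fun v => -(v : ℤ), fun _ => ⟨hC.locallyRealizes.2, fun S h => absurd h (hcyc S),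
          fun A hA => ?_⟩⟩
        obtain rfl : A = ⟨S, hS'⟩ := Subtype.ext (hA.eq hS)
        exact ⟨fun h => absurd h hu, fun _ a b _ _ hab _ => by simpa using hab⟩
    · obtain ⟨hY, h5⟩ := hS.cyclic_of_not_complete H R₀ hC
      have hS' : IsCycleRegion G S ∧ 5 ≤ S.card := ⟨(hS.isCycleRegion_iff H).2 hY, h5⟩
      obtain ⟨q, hq, hlt⟩ := hS.exists_locallyRealizes H hY (hσ ⟨S, hS'⟩)
      refine ⟨q, fun _ => ⟨hq, fun S₂ hS₂ => ?_, fun A hA => ?_⟩⟩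
      · obtain rfl : S₂ = ⟨S, hS'⟩ := Subtype.ext (hS₂.eq hS)
        exact hlt
      · exact absurd ((hA.isCompleteRegion_iff H).1 A.2) hC
  choose D hD using hloc
  have halt : ∀ i j v w, Node (edgeIntervals G) i j → Complete (edgeIntervals G) i j →
      Block (edgeIntervals G) i j v w → Node (edgeIntervals G) v w →
      Complete (edgeIntervals G) v w →
      (Inc (edgeIntervals G) (D i j) i j ∧ Inc (edgeIntervals G) (fun x => -D v w x) v w) ∨
      (Inc (edgeIntervals G) (fun x => -D i j x) i j ∧ Inc (edgeIntervals G) (D v w) v w) := by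
    intro i j v w hN hC hB hN' hC'
    obtain ⟨S, hS⟩ := hN.exists_regionAt
    obtain ⟨S', hS'⟩ := hN'.exists_regionAt
    have h1 := (hS.isCompleteRegion_iff H).2 hC
    have h2 := (hS'.isCompleteRegion_iff H).2 hC'
    have h3 := hup ⟨S, h1⟩ ⟨S', h2⟩ ((completeRegionGraph_adj_iff H hS hS').2 (.inl hB))
    have h4 := (hD i j hN).2.2 ⟨S, h1⟩ hS
    have h5 := (hD v w hN').2.2 ⟨S', h2⟩ hS'
    tauto
  obtain ⟨p, R, hE, hp⟩ := exists_realization H D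
    (fun i j v v' hN => (hD i j hN).1.1 v v')
    (fun i j a b hN => (hD i j hN).1.2 a b)
    (fun i j v w hN hC hB hN' hC' h1 h2 => by
      rcases halt i j v w hN hC hB hN' hC' with h | h
      · exact h2.not_inc_neg H hN' h.2
      · exact h1.not_inc_neg H hN h.1)
    (fun i j v w hN hC hB hN' hC' h1 h2 => by
      rcases halt i j v w hN hC hB hN' hC' with h | h
      · exact h.1.not_inc_neg H hN h1
      · exact h.2.not_inc_neg H hN' h2)
  set π : Equiv.Perm (Fin (k - 1)) := Tuple.sort (fun x : Fin (k - 1) => p x) with hπ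
  have hpos : ∀ x y, x < k - 1 → y < k - 1 → (pos π x < pos π y ↔ p x < p y) := by
    intro x y hx hy
    have h1 := pos_val π ⟨x, hx⟩
    have h2 := pos_val π ⟨y, hy⟩
    simp only at h1 h2
    rw [h1, h2, Nat.cast_lt, ← Fin.lt_def, hπ]
    exact sort_symm_lt_iff (f := fun x : Fin (k - 1) => p x)
      (fun x y hxy => Fin.ext (R.inj x y x.2 y.2 hxy))
  have hG : permGraph k π = G := by
    rw [permGraph_eq_iff]
    intro a b
    rw [← hE]
    refine and_congr_right fun hab => and_congr_right fun hb => ?_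
    refine forall₃_congr fun x y z => ⟨fun h x1 x2 z1 z2 y1 y2 y3 => ?_,
      fun h x1 x2 z1 z2 y1 y2 y3 => ?_⟩
    · exact h x1 x2 z1 z2 y1 ((hpos x y (by omega) y1).2 y2) ((hpos y z y1 (by omega)).2 y3)
    · exact h x1 x2 z1 z2 y1 ((hpos x y (by omega) y1).1 y2) ((hpos y z y1 (by omega)).1 y3)
  have hposD : ∀ i j v v', Node (edgeIntervals G) i j → Vert (edgeIntervals G) i j v →
      Vert (edgeIntervals G) i j v' → v < j → v' < j →
      (pos π v < pos π v' ↔ D i j v < D i j v') := by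
    intro i j v v' hN hv hv' hvj hvj'
    have hjn := H.le hN.1.1
    rw [hpos v v' (by omega) (by omega), hp i j v v' hN hv hv' hvj hvj']
  refine ⟨π, hG, fun S => ?_, fun A => ?_⟩
  · obtain ⟨i, j, hS⟩ := S.2.1.1.exists_regionAt H
    have hjn := H.le hS.1.1.1
    refine perm_eq_of_symm_lt fun s t hst => ?_
    rw [hS.pattern_symm_lt H fun v v' _ _ hv hv' => pos_inj π v v' (by omega) (by omega)] at hst
    have hs := (hS.vert_iff H).2 ⟨s, rfl⟩
    have ht := (hS.vert_iff H).2 ⟨t, rfl⟩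
    rw [hposD i j _ _ hS.1 hs.1 ht.1 hs.2 ht.2] at hst
    exact ((hD i j hS.1).2.1 S hS s t).2 hst
  · obtain ⟨i, j, hA⟩ := A.2.1.exists_regionAt H
    have h1 := (hD i j hA.1).2.2 A hA
    have h2 : Inc (edgeIntervals G) (pos π) i j ↔ Inc (edgeIntervals G) (D i j) i j := by
      constructor
      · exact fun h a b ha hb hab hbj =>
          (hposD i j a b hA.1 ha hb (by omega) hbj).1 (h a b ha hb hab hbj)
      · exact fun h a b ha hb hab hbj =>
          (hposD i j a b hA.1 ha hb (by omega) hbj).2 (h a b ha hb hab hbj)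
    rw [hA.ascending_iff H, h2]
    refine ⟨fun h => ?_, h1.1⟩
    by_contra hu
    exact h.not_inc_neg H hA.1 (h1.2 hu)

theorem prod_simpleCount (G : SimpleGraph (Fin k)) :
    Nat.card (∀ S : {S : Finset (Fin k) // IsCycleRegion G S ∧ 5 ≤ S.card},
      {σ : Equiv.Perm (Fin (S.val.card - 1)) // IsSimplePerm σ}) =
      ∏ i ∈ Finset.Icc 5 k, simpleCount i ^ cycleRegionCount G i := by
  classical
  rw [Nat.card_pi]
  change ∏ S : {S : Finset (Fin k) // IsCycleRegion G S ∧ 5 ≤ S.card}, simpleCount S.val.card = _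
  rw [← prod_fiberwise_of_maps_to (g := fun S => S.val.card) (t := Finset.Icc 5 k)]
  · refine prod_congr rfl fun i hi => ?_
    rw [prod_congr rfl (g := fun _ => simpleCount i) fun S hS => by rw [(mem_filter.1 hS).2],
      prod_const, cycleRegionCount]
    congr 1
    rw [← Fintype.card_coe, ← Nat.card_eq_fintype_card]
    have hi5 := (Finset.mem_Icc.1 hi).1
    refine Nat.card_congr ⟨fun S => ⟨S.1.1, S.1.2.1, (mem_filter.1 S.2).2⟩,
      fun S => ⟨⟨S.1, S.2.1, by have := S.2.2; omega⟩, by simp [S.2.2]⟩, fun S => rfl, fun S => rfl⟩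
  · intro S _
    exact Finset.mem_Icc.2 ⟨S.2.2, by simpa using card_le_univ S.val⟩

end

theorem theoremT (k : ℕ) (hk : 3 ≤ k) (G : SimpleGraph (Fin k)) (hG : G ∈ permGraphs k) :
    Nat.card {π : Equiv.Perm (Fin (k - 1)) // permGraph k π = G} =
      2 ^ completeComponentCount G *
        ∏ i ∈ Finset.Icc 5 k, simpleCount i ^ cycleRegionCount G i := by
  classical
  obtain ⟨π₀, hπ₀⟩ := hG
  have H : IntervalSystem (k - 1) (edgeIntervals G) := by
    have h := posInterval_system (n := k - 1) (by omega) (pos_inj π₀)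
    rwa [show PosInterval (k - 1) (pos π₀) = edgeIntervals G from
      funext₂ fun a b => propext (permGraph_eq_iff.1 hπ₀ a b)] at h
  have R₀ := permGraph_realizes H hπ₀
  rw [← prod_simpleCount, completeComponentCount, mul_comm, show 2 = Nat.card Bool by simp,
    ← Nat.card_fun, ← Nat.card_prod]
  -- On each component of complete regions, the directions are compared with those in `π₀`.
  refine Nat.card_eq_of_bijective (fun π =>
    (fun S => ⟨pattern S.val (pos π.val), isSimplePerm_pattern H (permGraph_realizes H π.2) S.2.1⟩,
      fun C => decide (Ascending (pos π.val) C.out.val ↔ Ascending (pos π₀) C.out.val)))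
    ⟨fun π τ hπτ => ?_, fun ⟨σ, χ⟩ => ?_⟩
  · obtain ⟨h1, h2⟩ := Prod.mk.inj hπτ
    refine Subtype.ext (eq_of_pattern_eq H π.2 τ.2 (fun S hS h5 => ?_) fun S hS => ?_)
    · exact congrArg Subtype.val (congrFun h1 ⟨S, hS, h5⟩)
    · have h3 := congrFun h2 ((completeRegionGraph G).connectedComponentMk ⟨S, hS⟩)
      have h4 : (completeRegionGraph G).Reachable
          ((completeRegionGraph G).connectedComponentMk ⟨S, hS⟩).out ⟨S, hS⟩ :=
        SimpleGraph.ConnectedComponent.exact (Quot.out_eq _)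
      have h5 := ascending_iff_of_reachable H (permGraph_realizes H π.2) R₀ h4
      have h6 := ascending_iff_of_reachable H (permGraph_realizes H τ.2) R₀ h4
      have h7 := h5.symm.trans ((decide_eq_decide.1 h3).trans h6)
      by_cases h8 : Ascending (pos π₀) S <;>
        simpa only [h8, iff_true, iff_false, not_iff_not] using h7
  · obtain ⟨π, hπ, h1, h2⟩ := exists_perm_of_pattern H R₀ (fun S => (σ S).val)
      (fun S => (σ S).2)
      (fun A => χ ((completeRegionGraph G).connectedComponentMk A) = true ↔
        Ascending (pos π₀) A.val) (fun A B hAB => by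
          rw [SimpleGraph.ConnectedComponent.connectedComponentMk_eq_of_adj hAB,
            ascending_iff_not_of_adj H R₀ hAB]
          tauto)
    refine ⟨⟨π, hπ⟩, Prod.ext (funext fun S => Subtype.ext (h1 S)) (funext fun C => ?_)⟩
    have h3 := h2 C.out
    rw [show (completeRegionGraph G).connectedComponentMk C.out = C from Quot.out_eq C] at h3
    simp only [h3]
    by_cases h4 : Ascending (pos π₀) C.out.val <;> cases h5 : χ C <;> simp [h4]
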